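/- Let $\omega:[0,1)\to[0,\infty)$ be integrable with $\widehat\omega(r)=\int_r^1\omega(s)\,ds>0$ for all $0\le r<1$, extended to the unit disc $\mathbb D$ as a radial weight by $\omega(z)=\omega(|z|)$. Let $0<p<\infty$ and let $k\ge 1$ be an integer, and let $dA=\frac{dx\,dy}{\pi}$. The following are equivalent: (1) there is a constant $C=C(\omega,p,k)>0$ such that for every analytic function $f$ on $\mathbb D$, with both quantities understood in $[0,\infty]$, $$C^{-1}\int_{\mathbb D}|f(z)|^p\omega(z)\,dA(z)\;\le\;\int_{\mathbb D}|f^{(k)}(z)|^p(1-|z|)^{kp}\omega(z)\,dA(z)+\sum_{j=0}^{k-1}|f^{(j)}(0)|^p\;\le\; C\int_{\mathbb D}|f(z)|^p\omega(z)\,dA(z);$$ (2) $\omega\in\mathcal D=\widehat{\mathcal D}\cap\check{\mathcal D}$, that is, there are constants $C_1\ge1$, $K>1$ and $C_2>1$ such that for all $0\le r<1$, $$\widehat\omega(r)\le C_1\,\widehat\omega\!\left(\tfrac{1+r}{2}\right)\qquad\text{and}\qquad \widehat\omega(r)\ge C_2\,\widehat\omega\!\left(1-\tfrac{1-r}{K}\right).$$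 -/

import Mathlib

open MeasureTheory Set
open scoped NNReal ENNReal

noncomputable section

/-- The open unit disc of the complex plane. -/
def unitDisc : Set ℂ := Metric.ball (0 : ℂ) 1

/-- The normalized area measure `dA = dx dy / π`. -/
def areaMeasure : Measure ℂ := (ENNReal.ofReal Real.pi)⁻¹ • volume

/-- The tail integral `∫_r^1 ω(s) ds`. -/
def tailIntegral (ω : ℝ → ℝ) (r : ℝ) : ℝ := ∫ s in r..1, ω s

/-- `ω` induces the radial weight `z ↦ ω |z|` on the unit disc: it is nonnegative and integrable
on `[0, 1)`, and its tail integrals are positive. Only the values of `ω` on `[0, 1)` matter. -/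
structure IsRadialWeight (ω : ℝ → ℝ) : Prop where
  nonneg : ∀ r ∈ Ico (0 : ℝ) 1, 0 ≤ ω r
  integrableOn : IntegrableOn ω (Ico (0 : ℝ) 1)
  tail_pos : ∀ r ∈ Ico (0 : ℝ) 1, 0 < tailIntegral ω r

/-- The doubling condition on tail integrals. -/
def IsUpperDoubling (ω : ℝ → ℝ) : Prop :=
  ∃ C : ℝ, 1 ≤ C ∧
    ∀ r ∈ Ico (0 : ℝ) 1, tailIntegral ω r ≤ C * tailIntegral ω ((1 + r) / 2)

/-- The reverse doubling condition on tail integrals. -/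
def IsLowerDoubling (ω : ℝ → ℝ) : Prop :=
  ∃ K C : ℝ, 1 < K ∧ 1 < C ∧
    ∀ r ∈ Ico (0 : ℝ) 1, C * tailIntegral ω (1 - (1 - r) / K) ≤ tailIntegral ω r

/-- Two-sided doubling: the intersection of the two classes. -/
def IsTwoSidedDoubling (ω : ℝ → ℝ) : Prop := IsUpperDoubling ω ∧ IsLowerDoubling ω

/-- The `p`-th power of the norm of `f` in the weighted Bergman space induced by `ω`, that is
`∫_D |f(z)|^p ω(|z|) dA(z)`, as an element of `[0, ∞]`. -/
def bergmanNormPow (ω : ℝ → ℝ) (p : ℝ) (f : ℂ → ℂ) : ℝ≥0∞ :=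
  ∫⁻ z in unitDisc, ‖f z‖ₑ ^ p * ENNReal.ofReal (ω ‖z‖) ∂areaMeasure

/-- `∫_D |f^{(k)}(z)|^p (1 - |z|)^{kp} ω(|z|) dA(z) + ∑_{j<k} |f^{(j)}(0)|^p`, as an element
of `[0, ∞]`. -/
def derivativeNormPow (ω : ℝ → ℝ) (p : ℝ) (k : ℕ) (f : ℂ → ℂ) : ℝ≥0∞ :=
  (∫⁻ z in unitDisc, ‖iteratedDeriv k f z‖ₑ ^ p * ENNReal.ofReal ((1 - ‖z‖) ^ ((k : ℝ) * p)) *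
      ENNReal.ofReal (ω ‖z‖) ∂areaMeasure) +
    ∑ j ∈ Finset.range k, ‖iteratedDeriv j f 0‖ₑ ^ p

end

open scoped Real Topology

/-! In polar coordinates both quantities become integrals, against `ω(r) dr`, of the means of
`|f|^p` and `|f^{(k)}|^p` over circles. These means increase with the radius, because `|g|^p` is
subharmonic for analytic `g` and every `p > 0`. Subharmonicity also replaces Minkowski's inequality,
which fails for `p < 1`.

Doubling implies the equivalence. Along radii `r_n = 1 - κ^n` the two doubling conditions say that
the tail of `ω` from `r_n` is comparable to the mass of `[r_n, r_{n+1})` and decays by a factor `q <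
1` at each step (`IsRadialWeight.exists_geometricDoubling`). The integrals can then be compared with
the sums `geomSum`. Cauchy's estimate on discs of radius comparable to `1 - r` controls derivatives
by `f`. Conversely, passing from `r_n` to `r_{n+1}` multiplies a mean by at most `η` and adds a
derivative term (`derivMean_add_le`). Here `η > 1` is as close to `1` as desired, so `η q < 1` and
the recursion sums (`geomSum_le_geomSum_succ`). Induction on the order of the derivative then
reaches `k`.

The equivalence implies doubling. Test it on `z^n`, with moments `A_n` of the function and `E_n` of
its `k`-th derivative. The factor `(n(1-r))^k` is large where `1 - r ≥ M/n`, so `E_n ≤ C A_n` forces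
`A_n` to be controlled by the tail from `1 - M/n` (`powMoment_le_tailIntegral`). The elementary
bound `r^n ≥ e^{-2N}` for `1 - r ≤ N/n` bounds `A_n` below by a multiple of the tail from `1 - N/n`,
and taking `N = 4M` gives upper doubling. For lower doubling, `A_{2n} ≤ C E_{2n}` and `E_{2n}` is
small outside `1 - L/n ≤ r < 1 - ε/n`, so this annulus carries a fixed proportion of the tail
(`derivMoment_two_mul_le`). -/

/-! ### Submean value property of `|f|^p`. -/

/-- Jensen's formula: the difference of the two sides is a sum over the zeros of `f` with
nonnegative terms. -/
theorem log_norm_le_circleAverage {f : ℂ → ℂ} {c : ℂ} {R : ℝ} (hR : 0 < R)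
    (hf : AnalyticOnNhd ℂ f (Metric.closedBall c R)) (hc : f c ≠ 0) :
    Real.log ‖f c‖ ≤ Real.circleAverage (fun z => Real.log ‖f z‖) c R := by
  have hf' : AnalyticOnNhd ℂ f (Metric.closedBall c |R|) := by rwa [abs_of_pos hR]
  rw [AnalyticOnNhd.circleAverage_log_norm hR.ne' hf' hc]
  have : 0 ≤ ∑ᶠ u, (MeromorphicOn.divisor f (Metric.closedBall c |R|) u : ℝ) *
      Real.log (R * ‖c - u‖⁻¹) := by
    refine finsum_nonneg fun u => ?_
    by_cases hu : u ∈ Metric.closedBall c |R|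
    · refine mul_nonneg (mod_cast MeromorphicOn.AnalyticOnNhd.divisor_nonneg hf' u) ?_
      rcases eq_or_ne u c with rfl | huc
      -- The term at the centre vanishes by convention, since `log (R * 0⁻¹) = log 0 = 0`.
      · simp
      · apply Real.log_nonneg
        have h0 : 0 < ‖c - u‖ := norm_pos_iff.2 (sub_ne_zero.2 huc.symm)
        rw [Metric.mem_closedBall, dist_eq_norm', abs_of_pos hR] at hu
        rw [← div_eq_mul_inv, le_div_iff₀ h0]
        linarith
    · simp [hu]
  linarith

/-- Average the tangent line inequality `e^x ≥ 1 + x` at `x = p (log |f z| - log |f c|)` and apply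
the logarithmic case. -/
theorem norm_rpow_le_circleAverage {f : ℂ → ℂ} {c : ℂ} {R p : ℝ} (hR : 0 < R) (hp : 0 < p)
    (hf : AnalyticOnNhd ℂ f (Metric.closedBall c R)) :
    ‖f c‖ ^ p ≤ Real.circleAverage (fun z => ‖f z‖ ^ p) c R := by
  by_cases hc : f c = 0
  · rw [hc, norm_zero, Real.zero_rpow hp.ne']
    exact Real.circleAverage_nonneg_of_nonneg fun _ _ => by positivity
  have hf' : AnalyticOnNhd ℂ f (Metric.closedBall c |R|) := by rwa [abs_of_pos hR]
  have hfs : AnalyticOnNhd ℂ f (Metric.sphere c |R|) := hf'.mono Metric.sphere_subset_closedBall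
  classical
  set L := Real.log ‖f c‖ with hL
  -- The default `log 0 = 0` could break the pointwise bound at zeros of `f`. The value `L - 1 / p`
  -- makes the tangent line vanish there, and a change on a codiscrete-complement set does not
  -- affect the average.
  let g : ℂ → ℝ := fun z => if f z = 0 then L - 1 / p else Real.log ‖f z‖
  have hg : (fun z => Real.log ‖f z‖) =ᶠ[Filter.codiscreteWithin (Metric.sphere c |R|)] g := by
    have h1 := hf'.preimage_zero_mem_codiscreteWithin hc (by simp)
      ⟨⟨c, by simp⟩, (convex_closedBall c |R|).isPreconnected⟩
    have h2 := Filter.codiscreteWithin_mono (Metric.sphere_subset_closedBall (x := c) (ε := |R|)) h1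
    filter_upwards [h2] with z hz
    have : f z ≠ 0 := hz
    simp [g, this]
  have hgi : CircleIntegrable g c R :=
    (hfs.meromorphicOn.circleIntegrable_log_norm).congr_codiscreteWithin hg
  have hgL : L ≤ Real.circleAverage g c R := by
    rw [← Real.circleAverage_congr_codiscreteWithin hg hR.ne']
    exact log_norm_le_circleAverage hR hf hc
  have hA : 0 < ‖f c‖ := norm_pos_iff.2 hc
  have hfi : CircleIntegrable (fun z => ‖f z‖ ^ p) c R := by
    apply ContinuousOn.circleIntegrable'
    exact hfs.continuousOn.norm.rpow_const fun _ _ => Or.inr hp.le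
  have hpt : ∀ z, ‖f c‖ ^ p * p * g z + ‖f c‖ ^ p * (1 - p * L) ≤ ‖f z‖ ^ p := by
    intro z
    by_cases hz : f z = 0
    · simp only [g, hz, if_true, norm_zero, Real.zero_rpow hp.ne']
      apply le_of_eq
      field_simp
      ring
    · simp only [g, hz, if_false]
      have hz' : 0 < ‖f z‖ := norm_pos_iff.2 hz
      have e := Real.add_one_le_exp (p * (Real.log ‖f z‖ - L))
      have : ‖f z‖ ^ p = ‖f c‖ ^ p * Real.exp (p * (Real.log ‖f z‖ - L)) := by
        rw [Real.rpow_def_of_pos hz', Real.rpow_def_of_pos hA, ← Real.exp_add, ← hL]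
        ring_nf
      rw [this]
      have hpos : 0 < ‖f c‖ ^ p := Real.rpow_pos_of_pos hA p
      nlinarith
  have hci : CircleIntegrable (fun _ => ‖f c‖ ^ p * (1 - p * L)) c R := circleIntegrable_const _ _ _
  have hmi : CircleIntegrable (fun z => (‖f c‖ ^ p * p) • g z) c R := hgi.const_smul
  have h := Real.circleAverage_mono (hmi.add hci) hfi (fun z _ => hpt z)
  refine le_trans ?_ h
  rw [Real.circleAverage_add hmi hci, Real.circleAverage_const, Real.circleAverage_fun_smul,
    smul_eq_mul]
  have hpos : 0 < ‖f c‖ ^ p := Real.rpow_pos_of_pos hA p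
  have : 0 ≤ ‖f c‖ ^ p * p * (Real.circleAverage g c R - L) :=
    mul_nonneg (by positivity) (by linarith)
  linarith

/-! ### Means over circles, with normalized Haar measure on `ℝ / 2πℤ`. -/

instance : Fact (0 < 2 * π) := ⟨Real.two_pi_pos⟩

/-- The point of the unit circle with the given argument. -/
noncomputable def circlePoint (t : AddCircle (2 * π)) : ℂ := (AddCircle.toCircle t : ℂ)

@[simp] theorem norm_circlePoint (t : AddCircle (2 * π)) : ‖circlePoint t‖ = 1 := by
  exact Circle.norm_coe _

@[fun_prop] theorem continuous_circlePoint : Continuous circlePoint :=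
  continuous_subtype_val.comp AddCircle.continuous_toCircle

theorem circlePoint_add (s t : AddCircle (2 * π)) :
    circlePoint (s + t) = circlePoint s * circlePoint t := by
  simp [circlePoint, AddCircle.toCircle_add]

@[simp] theorem circlePoint_zero : circlePoint 0 = 1 := by
  simp [circlePoint, AddCircle.toCircle_zero]

theorem circlePoint_coe (θ : ℝ) : circlePoint (θ : AddCircle (2 * π)) = Complex.exp (θ * Complex.I) := by
  rw [circlePoint, AddCircle.toCircle_apply_mk, Circle.coe_exp]
  congr 3
  field_simp

theorem exists_circlePoint (z : ℂ) : ∃ t, z = ‖z‖ * circlePoint t :=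
  ⟨((z.arg : ℝ) : AddCircle (2 * π)), by rw [circlePoint_coe, Complex.norm_mul_exp_arg_mul_I]⟩

/-- Mean value of `F` over the circle through `z` centred at the origin. -/
noncomputable def circleMean (F : ℂ → ℝ≥0∞) (z : ℂ) : ℝ≥0∞ :=
  ∫⁻ t, F (z * circlePoint t) ∂AddCircle.haarAddCircle

theorem lintegral_haarAddCircle (F : AddCircle (2 * π) → ℝ≥0∞) (a : ℝ) :
    ∫⁻ θ in Ioc a (a + 2 * π), F θ =
      ENNReal.ofReal (2 * π) * ∫⁻ t, F t ∂AddCircle.haarAddCircle := by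
  rw [AddCircle.lintegral_preimage, AddCircle.volume_eq_smul_haarAddCircle,
    lintegral_smul_measure, smul_eq_mul]

theorem enorm_rpow_le_lintegral_circle {f : ℂ → ℂ} {c : ℂ} {R p : ℝ} (hR : 0 < R) (hp : 0 < p)
    (hf : AnalyticOnNhd ℂ f (Metric.closedBall c R)) :
    ‖f c‖ₑ ^ p ≤ ∫⁻ t, ‖f (c + R * circlePoint t)‖ₑ ^ p ∂AddCircle.haarAddCircle := by
  have key := norm_rpow_le_circleAverage hR hp hf
  have h2 : (0 : ℝ) < 2 * π := Real.two_pi_pos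
  have hcirc := lintegral_haarAddCircle (fun t => ‖f (c + R * circlePoint t)‖ₑ ^ p) 0
  have e1 : ∀ x : ℂ, ‖x‖ₑ ^ p = ENNReal.ofReal (‖x‖ ^ p) := fun x => by
    rw [← ENNReal.ofReal_rpow_of_nonneg (norm_nonneg _) hp.le, ofReal_norm]
  have hfs : AnalyticOnNhd ℂ f (Metric.sphere c |R|) :=
    hf.mono (by rw [abs_of_pos hR]; exact Metric.sphere_subset_closedBall)
  have hfi : CircleIntegrable (fun z => ‖f z‖ ^ p) c R := by
    apply ContinuousOn.circleIntegrable'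
    exact hfs.continuousOn.norm.rpow_const fun _ _ => Or.inr hp.le
  rw [Real.circleAverage_def, intervalIntegral.integral_of_le h2.le, smul_eq_mul,
    le_inv_mul_iff₀ h2] at key
  have hfi' := (intervalIntegrable_iff_integrableOn_Ioc_of_le h2.le).1 hfi
  have key2 := ENNReal.ofReal_le_ofReal key
  rw [ofReal_integral_eq_lintegral_ofReal hfi' (Filter.Eventually.of_forall fun _ => by positivity),
    ENNReal.ofReal_mul h2.le, ← e1] at key2
  rw [← ENNReal.mul_le_mul_iff_right (a := ENNReal.ofReal (2 * π)) (by simpa using Real.pi_pos)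
    ENNReal.ofReal_ne_top, ← hcirc, zero_add]
  refine key2.trans (le_of_eq ?_)
  refine lintegral_congr fun θ => ?_
  rw [← e1, circlePoint_coe]
  simp [circleMap]

theorem circleMean_mul_circlePoint (F : ℂ → ℝ≥0∞) (z : ℂ) (s : AddCircle (2 * π)) :
    circleMean F (z * circlePoint s) = circleMean F z := by
  simp only [circleMean, mul_assoc, ← circlePoint_add]
  exact lintegral_add_left_eq_self (fun t => F (z * circlePoint t)) s

theorem circleMean_norm (F : ℂ → ℝ≥0∞) (z : ℂ) : circleMean F ‖z‖ = circleMean F z := by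
  obtain ⟨t, ht⟩ := exists_circlePoint z
  conv_rhs => rw [ht]
  rw [circleMean_mul_circlePoint]

theorem circleMean_zero (F : ℂ → ℝ≥0∞) : circleMean F 0 = F 0 := by
  simp [circleMean]

/-! ### Subharmonic functions and the monotonicity of their circle means. -/

/-- Finite continuous functions on the unit disc with the submean value property on circles. -/
structure IsSubharmonicOnDisc (F : ℂ → ℝ≥0∞) : Prop where
  continuousOn : ContinuousOn F unitDisc
  ne_top : ∀ z ∈ unitDisc, F z ≠ ∞
  le_lintegral_circle : ∀ c : ℂ, ∀ R : ℝ, 0 < R → ‖c‖ + R < 1 →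
    F c ≤ ∫⁻ t, F (c + R * circlePoint t) ∂AddCircle.haarAddCircle

theorem mem_unitDisc {z : ℂ} : z ∈ unitDisc ↔ ‖z‖ < 1 := by
  simp [unitDisc]

theorem isSubharmonicOnDisc_enorm_rpow {f : ℂ → ℂ} (hf : AnalyticOnNhd ℂ f unitDisc) {p : ℝ}
    (hp : 0 < p) : IsSubharmonicOnDisc fun z => ‖f z‖ₑ ^ p where
  continuousOn := ENNReal.continuous_rpow_const.comp_continuousOn hf.continuousOn.enorm
  ne_top z _ := by finiteness
  le_lintegral_circle c R hR h := enorm_rpow_le_lintegral_circle hR hp <| hf.mono fun z hz => by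
    rw [mem_unitDisc]
    have := norm_le_norm_add_norm_sub' z c
    rw [Metric.mem_closedBall, dist_eq_norm] at hz
    linarith

theorem norm_mul_circlePoint (z : ℂ) (t : AddCircle (2 * π)) : ‖z * circlePoint t‖ = ‖z‖ := by simp

theorem norm_add_mul_circlePoint_le (c : ℂ) {R : ℝ} (hR : 0 ≤ R) (t : AddCircle (2 * π)) :
    ‖c + R * circlePoint t‖ ≤ ‖c‖ + R := by
  refine (norm_add_le _ _).trans ?_
  simp [abs_of_nonneg hR]

theorem circleMean_le_of_forall_le {F : ℂ → ℝ≥0∞} {z : ℂ} {B : ℝ≥0∞}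
    (h : ∀ w, ‖w‖ = ‖z‖ → F w ≤ B) : circleMean F z ≤ B := by
  refine (lintegral_mono fun t => h _ (norm_mul_circlePoint z t)).trans ?_
  simp

theorem circleMean_mono {F G : ℂ → ℝ≥0∞} {z : ℂ} (h : ∀ w, ‖w‖ = ‖z‖ → F w ≤ G w) :
    circleMean F z ≤ circleMean G z :=
  lintegral_mono fun t => h _ (norm_mul_circlePoint z t)

theorem circleMean_mul_norm (F : ℂ → ℝ≥0∞) (W : ℝ → ℝ≥0∞) (z : ℂ) (hW : W ‖z‖ ≠ ∞) :
    circleMean (fun w => F w * W ‖w‖) z = circleMean F z * W ‖z‖ := by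
  simp only [circleMean, norm_mul_circlePoint]
  rw [lintegral_mul_const' _ _ hW]

theorem circleMean_const_mul (F : ℂ → ℝ≥0∞) (a : ℝ≥0∞) (ha : a ≠ ∞) (z : ℂ) :
    circleMean (fun w => a * F w) z = a * circleMean F z :=
  lintegral_const_mul' _ _ ha

theorem continuous_comp_mul_circlePoint {F : ℂ → ℝ≥0∞} (hF : ContinuousOn F unitDisc) {z : ℂ}
    (hz : ‖z‖ < 1) : Continuous fun t => F (z * circlePoint t) :=
  hF.comp_continuous (by fun_prop) fun t => by rwa [mem_unitDisc, norm_mul_circlePoint]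

theorem isOpen_unitDisc : IsOpen unitDisc := Metric.isOpen_ball

theorem exists_bound_closedBall {F : ℂ → ℝ≥0∞} (hF : ContinuousOn F unitDisc)
    (hfin : ∀ z ∈ unitDisc, F z ≠ ∞) {ρ : ℝ} (hρ : ρ < 1) :
    ∃ B : ℝ≥0∞, B ≠ ∞ ∧ ∀ w, ‖w‖ ≤ ρ → F w ≤ B := by
  by_cases h0 : 0 ≤ ρ
  · have hsub : Metric.closedBall (0 : ℂ) ρ ⊆ unitDisc := Metric.closedBall_subset_ball hρ
    obtain ⟨z, hz, hm⟩ := (isCompact_closedBall (0 : ℂ) ρ).exists_isMaxOn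
      ⟨0, by simpa using h0⟩ (hF.mono hsub)
    exact ⟨F z, hfin z (hsub hz), fun w hw => hm (by simpa using hw)⟩
  · exact ⟨0, by simp, fun w hw => absurd ((norm_nonneg w).trans hw) h0⟩

theorem continuousOn_circleMean {F : ℂ → ℝ≥0∞} (hF : ContinuousOn F unitDisc)
    (hfin : ∀ z ∈ unitDisc, F z ≠ ∞) : ContinuousOn (circleMean F) unitDisc := by
  intro z hz
  apply ContinuousAt.continuousWithinAt
  have hz' := mem_unitDisc.1 hz
  obtain ⟨ρ, hzρ, hρ⟩ := exists_between hz'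
  obtain ⟨B, hB, hFB⟩ := exists_bound_closedBall hF hfin hρ
  have hnear : ∀ᶠ w in 𝓝 z, ‖w‖ < ρ :=
    continuous_norm.continuousAt.eventually (gt_mem_nhds hzρ)
  refine tendsto_lintegral_filter_of_dominated_convergence (fun _ => B) ?_ ?_ ?_ ?_
  · filter_upwards [hnear] with w hw
    exact (continuous_comp_mul_circlePoint hF (hw.trans hρ)).measurable
  · filter_upwards [hnear] with w hw
    exact Filter.Eventually.of_forall fun t => hFB _ (by rw [norm_mul_circlePoint]; exact hw.le)
  · simpa using hB
  · refine Filter.Eventually.of_forall fun t => ?_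
    have hmem : z * circlePoint t ∈ unitDisc := by rwa [mem_unitDisc, norm_mul_circlePoint]
    have : ContinuousAt F (z * circlePoint t) := hF.continuousAt (isOpen_unitDisc.mem_nhds hmem)
    exact this.tendsto.comp ((continuous_mul_const _).tendsto z)

theorem circleMean_ne_top {F : ℂ → ℝ≥0∞} (hF : ContinuousOn F unitDisc)
    (hfin : ∀ z ∈ unitDisc, F z ≠ ∞) {z : ℂ} (hz : ‖z‖ < 1) : circleMean F z ≠ ∞ := by
  obtain ⟨B, hB, hFB⟩ := exists_bound_closedBall hF hfin hz
  exact ne_top_of_le_ne_top hB (circleMean_le_of_forall_le fun w hw => hFB w hw.le)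

/-- Averaging over rotations preserves the submean value property, by Tonelli and rotation
invariance. The maximum principle can therefore be applied to the mean itself. -/
theorem circleMean_le_lintegral_circle {F : ℂ → ℝ≥0∞} (hF : IsSubharmonicOnDisc F) {c : ℂ} {R : ℝ}
    (hR : 0 < R) (hcR : ‖c‖ + R < 1) :
    circleMean F c ≤ ∫⁻ t, circleMean F (c + R * circlePoint t) ∂AddCircle.haarAddCircle := by
  have hcont : Continuous fun q : AddCircle (2 * π) × AddCircle (2 * π) =>
      F ((c + R * circlePoint q.2) * circlePoint q.1) := by
    refine hF.continuousOn.comp_continuous (by fun_prop) fun q => ?_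
    rw [mem_unitDisc, norm_mul_circlePoint]
    exact (norm_add_mul_circlePoint_le c hR.le _).trans_lt hcR
  calc circleMean F c
      ≤ ∫⁻ s, ∫⁻ t, F (c * circlePoint s + R * circlePoint t) ∂AddCircle.haarAddCircle
          ∂AddCircle.haarAddCircle :=
        lintegral_mono fun s => hF.le_lintegral_circle _ R hR (by rwa [norm_mul_circlePoint])
    _ = ∫⁻ s, ∫⁻ t, F ((c + R * circlePoint t) * circlePoint s) ∂AddCircle.haarAddCircle
          ∂AddCircle.haarAddCircle := by
        refine lintegral_congr fun s => ?_
        rw [← lintegral_add_left_eq_self _ s]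
        refine lintegral_congr fun t => ?_
        rw [circlePoint_add]
        ring_nf
    _ = _ := by
        rw [lintegral_lintegral_swap hcont.measurable.aemeasurable]
        rfl

/-- Circle means of subharmonic functions increase with the radius. -/
theorem circleMean_le_circleMean {F : ℂ → ℝ≥0∞} (hF : IsSubharmonicOnDisc F) {z w : ℂ}
    (hzw : ‖z‖ ≤ ‖w‖) (hw : ‖w‖ < 1) : circleMean F z ≤ circleMean F w := by
  set u := circleMean F with hu
  have hcont : ContinuousOn u unitDisc := continuousOn_circleMean hF.continuousOn hF.ne_top
  have hsub : Metric.closedBall (0 : ℂ) ‖w‖ ⊆ unitDisc := Metric.closedBall_subset_ball hw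
  have hK := isCompact_closedBall (0 : ℂ) ‖w‖
  obtain ⟨a, ha, hmax⟩ := hK.exists_isMaxOn ⟨0, by simp⟩ (hcont.mono hsub)
  have hKa : IsCompact (Metric.closedBall (0 : ℂ) ‖w‖ ∩ u ⁻¹' {u a}) :=
    hK.of_isClosed_subset ((hcont.mono hsub).preimage_isClosed_of_isClosed
      Metric.isClosed_closedBall isClosed_singleton) inter_subset_left
  -- Among the maximum points of the radial function `u`, take one of largest modulus. If it is not
  -- on the boundary, the circle about it touching the boundary lies in the maximum set, which
  -- contradicts this choice.
  obtain ⟨b, ⟨hb, hba⟩, hbmax⟩ := hKa.exists_isMaxOn ⟨a, ha, rfl⟩ continuous_norm.continuousOn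
  have hba' : u b = u a := hba
  have hzK : z ∈ Metric.closedBall (0 : ℂ) ‖w‖ := by simpa using hzw
  refine (hmax hzK).trans ?_
  change u a ≤ u w
  have hb' : ‖b‖ ≤ ‖w‖ := by simpa using hb
  rcases hb'.eq_or_lt with hbw | hbw
  · rw [← hba', hu, ← circleMean_norm F b, hbw, circleMean_norm]
  exfalso
  set R := ‖w‖ - ‖b‖ with hRdef
  have hR : 0 < R := sub_pos.2 hbw
  have hbR : ‖b‖ + R < 1 := by linarith
  have hmem : ∀ t, b + R * circlePoint t ∈ Metric.closedBall (0 : ℂ) ‖w‖ := fun t => by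
    have := norm_add_mul_circlePoint_le b hR.le t
    simp only [Metric.mem_closedBall, dist_zero_right]
    linarith
  have hc : Continuous fun t => u (b + R * circlePoint t) :=
    hcont.comp_continuous (by fun_prop) fun t => hsub (hmem t)
  have hae : (fun t => u (b + R * circlePoint t)) =ᵐ[AddCircle.haarAddCircle] fun _ => u a := by
    have hle : ∀ t, u (b + R * circlePoint t) ≤ u a := fun t => hmax (hmem t)
    refine ae_eq_of_ae_le_of_lintegral_le (Filter.Eventually.of_forall hle) ?_ aemeasurable_const ?_
    · refine ne_top_of_le_ne_top (circleMean_ne_top hF.continuousOn hF.ne_top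
        (mem_unitDisc.1 (hsub ha))) ((lintegral_mono hle).trans ?_)
      simp [hu]
    · have := circleMean_le_lintegral_circle hF hR hbR
      rw [lintegral_const, measure_univ, mul_one, ← hba']
      exact this
  have heq := (Continuous.ae_eq_iff_eq _ hc continuous_const).1 hae
  -- The point of that circle in the direction of `b` has modulus `‖b‖ + R = ‖w‖`.
  obtain ⟨t, ht⟩ := exists_circlePoint b
  have h1 : u (b + R * circlePoint t) = u a := congrFun heq t
  have h2 : ‖b + R * circlePoint t‖ = ‖w‖ := by
    rw [ht, ← add_mul, norm_mul_circlePoint, ← Complex.ofReal_add, Complex.norm_real,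
      Real.norm_of_nonneg (by positivity), hRdef]
    ring
  have h3 := hbmax (show b + R * circlePoint t ∈ _ from ⟨hmem t, h1⟩)
  simp only [mem_ofPred_eq] at h3
  linarith

/-! ### Area integrals: polar coordinates and averages over discs. -/

theorem continuousOn_comp_polarCoord_symm {F : ℂ → ℝ≥0∞} {R : ℝ}
    (hF : ContinuousOn F (Metric.ball 0 R)) :
    ContinuousOn (fun q : ℝ × ℝ => F (q.1 * Complex.exp (q.2 * Complex.I)))
      (Ioo 0 R ×ˢ Ioo (-π) π) := by
  refine hF.comp (by fun_prop) fun q hq => ?_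
  have : ‖Complex.exp (q.2 * Complex.I)‖ = 1 := Complex.norm_exp_ofReal_mul_I _
  simp only [Metric.mem_ball, dist_zero_right, norm_mul, this, mul_one, Complex.norm_real,
    Real.norm_eq_abs, abs_of_pos hq.1.1]
  exact hq.1.2

theorem setLIntegral_ball_eq_lintegral_prod {F : ℂ → ℝ≥0∞} {R : ℝ} :
    ∫⁻ z in Metric.ball (0 : ℂ) R, F z =
      ∫⁻ q in Ioo 0 R ×ˢ Ioo (-π) π, ENNReal.ofReal q.1 * F (q.1 * Complex.exp (q.2 * Complex.I)) := by
  have hsym : ∀ q : ℝ × ℝ, Complex.polarCoord.symm q = q.1 * Complex.exp (q.2 * Complex.I) := by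
    intro q
    rw [Complex.polarCoord_symm_apply, Complex.exp_mul_I]
    simp
  rw [← lintegral_indicator measurableSet_ball, ← Complex.lintegral_comp_polarCoord_symm]
  have hsub : Ioo 0 R ×ˢ Ioo (-π) π ⊆ polarCoord.target := by
    rw [polarCoord_target]
    exact prod_mono Ioo_subset_Ioi_self subset_rfl
  have hm : MeasurableSet (Ioo 0 R ×ˢ Ioo (-π) π) := measurableSet_Ioo.prod measurableSet_Ioo
  have hmt : MeasurableSet polarCoord.target := by
    rw [polarCoord_target]
    exact measurableSet_Ioi.prod measurableSet_Ioo
  rw [← lintegral_indicator hm, ← lintegral_indicator hmt]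
  refine lintegral_congr fun q => ?_
  by_cases hq : q ∈ polarCoord.target
  · rw [indicator_of_mem hq, hsym]
    have hq' := hq
    rw [polarCoord_target] at hq'
    have hn : ‖(q.1 * Complex.exp (q.2 * Complex.I) : ℂ)‖ = q.1 := by
      rw [norm_mul, Complex.norm_exp_ofReal_mul_I, mul_one, Complex.norm_real,
        Real.norm_of_nonneg (le_of_lt hq'.1)]
    by_cases hR : q.1 < R
    · rw [indicator_of_mem (s := Ioo 0 R ×ˢ Ioo (-π) π) ⟨⟨hq'.1, hR⟩, hq'.2⟩,
        indicator_of_mem (s := Metric.ball 0 R) (by rwa [Metric.mem_ball, dist_zero_right, hn]), smul_eq_mul]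
    · rw [indicator_of_notMem (s := Ioo 0 R ×ˢ Ioo (-π) π) (fun h => hR h.1.2),
        indicator_of_notMem (s := Metric.ball 0 R) (by rwa [Metric.mem_ball, dist_zero_right, hn]), smul_zero]
  · rw [indicator_of_notMem hq, indicator_of_notMem fun h => hq (hsub h)]

theorem circleMean_ofReal_eq (F : ℂ → ℝ≥0∞) (r : ℝ) :
    ∫⁻ θ in Ioo (-π) π, F (r * Complex.exp (θ * Complex.I)) =
      ENNReal.ofReal (2 * π) * circleMean F r := by
  rw [restrict_Ioo_eq_restrict_Ioc, circleMean, ← lintegral_haarAddCircle _ (-π)]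
  simp only [circlePoint_coe]
  congr 3
  ring

/-- Integration in polar coordinates against a radial weight. -/
theorem setLIntegral_ball_mul_radial {F : ℂ → ℝ≥0∞} {W : ℝ → ℝ≥0∞} {R : ℝ}
    (hF : ContinuousOn F (Metric.ball 0 R)) (hW : AEMeasurable W (volume.restrict (Ioo 0 R))) :
    ∫⁻ z in Metric.ball (0 : ℂ) R, F z * W ‖z‖ ∂areaMeasure =
      ∫⁻ r in Ioo 0 R, 2 * ENNReal.ofReal r * circleMean F r * W r := by
  rw [areaMeasure, Measure.restrict_smul, lintegral_smul_measure, smul_eq_mul,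
    setLIntegral_ball_eq_lintegral_prod]
  have hcong : ∫⁻ q in Ioo 0 R ×ˢ Ioo (-π) π, ENNReal.ofReal q.1 *
      (F (q.1 * Complex.exp (q.2 * Complex.I)) * W ‖(q.1 * Complex.exp (q.2 * Complex.I) : ℂ)‖) =
      ∫⁻ q in Ioo 0 R ×ˢ Ioo (-π) π, ENNReal.ofReal q.1 *
      (F (q.1 * Complex.exp (q.2 * Complex.I)) * W q.1) := by
    refine setLIntegral_congr_fun (measurableSet_Ioo.prod measurableSet_Ioo) fun q hq => ?_
    rw [norm_mul, Complex.norm_exp_ofReal_mul_I, mul_one, Complex.norm_real,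
      Real.norm_of_nonneg (le_of_lt hq.1.1)]
  have hmF := (continuousOn_comp_polarCoord_symm hF).aemeasurable (μ := volume)
    (measurableSet_Ioo.prod measurableSet_Ioo)
  rw [hcong]
  rw [Measure.volume_eq_prod, ← Measure.prod_restrict] at hmF ⊢
  rw [lintegral_prod]
  · have hpi : (ENNReal.ofReal π)⁻¹ * ENNReal.ofReal (2 * π) = 2 := by
      rw [ENNReal.ofReal_mul zero_le_two, mul_comm, mul_assoc, ENNReal.mul_inv_cancel
        (by simpa using Real.pi_pos) ENNReal.ofReal_ne_top, mul_one, ENNReal.ofReal_ofNat]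
    rw [← lintegral_const_mul' _ _ (by simpa using Real.pi_pos)]
    refine setLIntegral_congr_fun measurableSet_Ioo fun r hr => ?_
    rw [lintegral_const_mul' _ _ ENNReal.ofReal_ne_top]
    have hmr : AEMeasurable (fun θ : ℝ => F (r * Complex.exp (θ * Complex.I)))
        (volume.restrict (Ioo (-π) π)) := by
      refine ContinuousOn.aemeasurable ?_ measurableSet_Ioo
      exact (continuousOn_comp_polarCoord_symm hF).comp (f := fun θ : ℝ => (r, θ)) (by fun_prop)
        fun θ hθ => ⟨hr, hθ⟩
    dsimp only
    rw [lintegral_mul_const'' _ hmr, circleMean_ofReal_eq, ← hpi]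
    ring
  · refine AEMeasurable.mul (by fun_prop) (hmF.mul ?_)
    exact hW.comp_fst

theorem circleMean_const (B : ℝ≥0∞) (z : ℂ) : circleMean (fun _ => B) z = B := by
  simp [circleMean]

theorem areaMeasure_ball (R : ℝ) (c : ℂ) :
    areaMeasure (Metric.ball c R) = ENNReal.ofReal R ^ 2 := by
  rw [areaMeasure, Measure.smul_apply, Complex.volume_ball, smul_eq_mul, mul_left_comm]
  have : (NNReal.pi : ℝ≥0∞) = ENNReal.ofReal π := by
    rw [ENNReal.ofReal, ← NNReal.coe_real_pi, Real.toNNReal_coe]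
  rw [this, ENNReal.inv_mul_cancel (by simpa using Real.pi_pos) ENNReal.ofReal_ne_top, mul_one]

theorem setLIntegral_ball_add_left (F : ℂ → ℝ≥0∞) (c : ℂ) (R : ℝ) :
    ∫⁻ z in Metric.ball (0 : ℂ) R, F (c + z) ∂areaMeasure =
      ∫⁻ z in Metric.ball c R, F z ∂areaMeasure := by
  simp only [areaMeasure, Measure.restrict_smul, lintegral_smul_measure]
  congr 1
  rw [← (measurePreserving_add_left volume c).setLIntegral_comp_preimage_emb
    (measurableEmbedding_addLeft c) F (Metric.ball c R)]
  have hpre : (c + ·) ⁻¹' Metric.ball c R = Metric.ball 0 R := by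
    ext z
    simp
  rw [hpre]

theorem setLIntegral_ball_mul_circlePoint (F : ℂ → ℝ≥0∞) (t : AddCircle (2 * π)) (R : ℝ) :
    ∫⁻ z in Metric.ball (0 : ℂ) R, F (z * circlePoint t) ∂areaMeasure =
      ∫⁻ z in Metric.ball (0 : ℂ) R, F z ∂areaMeasure := by
  simp only [areaMeasure, Measure.restrict_smul, lintegral_smul_measure]
  congr 1
  have hmp := (rotation (AddCircle.toCircle t)).measurePreserving
  have := hmp.setLIntegral_comp_preimage_emb
    (rotation (AddCircle.toCircle t)).toHomeomorph.measurableEmbedding F (Metric.ball 0 R)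
  rw [← this]
  have hpre : rotation (AddCircle.toCircle t) ⁻¹' Metric.ball 0 R = Metric.ball 0 R := by
    ext z
    simp only [mem_preimage, Metric.mem_ball, dist_zero_right, LinearIsometryEquiv.norm_map]
  rw [hpre]
  refine lintegral_congr fun z => ?_
  rw [rotation_apply, mul_comm]
  rfl

theorem IsSubharmonicOnDisc.mul_le_setLIntegral_ball {F : ℂ → ℝ≥0∞} (hF : IsSubharmonicOnDisc F)
    {c : ℂ} {δ : ℝ} (hcδ : ‖c‖ + δ ≤ 1) :
    F c * ENNReal.ofReal δ ^ 2 ≤ ∫⁻ z in Metric.ball c δ, F z ∂areaMeasure := by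
  have hcont : ContinuousOn (fun z => F (c + z)) (Metric.ball 0 δ) := by
    refine hF.continuousOn.comp (by fun_prop) fun z hz => ?_
    rw [mem_unitDisc]
    rw [Metric.mem_ball, dist_zero_right] at hz
    linarith [norm_add_le c z]
  have h1 := setLIntegral_ball_mul_radial (W := fun _ => 1) hcont aemeasurable_const
  have h2 := setLIntegral_ball_mul_radial (W := fun _ => 1) (F := fun _ => F c) (R := δ)
    continuousOn_const aemeasurable_const
  simp only [mul_one] at h1 h2
  rw [setLIntegral_const, areaMeasure_ball] at h2
  rw [h2, ← setLIntegral_ball_add_left, h1]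
  refine setLIntegral_mono' measurableSet_Ioo fun r hr => ?_
  rw [circleMean_const]
  gcongr
  exact hF.le_lintegral_circle c r hr.1 (by linarith [hr.2])

theorem IsSubharmonicOnDisc.mul_le_setLIntegral_larger_ball {F : ℂ → ℝ≥0∞}
    (hF : IsSubharmonicOnDisc F) {z v : ℂ} {ε δ : ℝ} (hv : ‖v - z‖ ≤ ε) (h : ‖z‖ + (ε + δ) ≤ 1) :
    F v * ENNReal.ofReal δ ^ 2 ≤ ∫⁻ w in Metric.ball z (ε + δ), F w ∂areaMeasure := by
  have hvn : ‖v‖ ≤ ‖z‖ + ‖v - z‖ := norm_le_norm_add_norm_sub' v z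
  refine (hF.mul_le_setLIntegral_ball (by linarith)).trans (lintegral_mono_set ?_)
  exact Metric.ball_subset_ball' (by rw [dist_eq_norm]; linarith)

/-- By rotation invariance and Tonelli, the mean of the disc integrals is the integral of
`circleMean F` over one disc, where monotonicity bounds it by its value at the outermost radius. -/
theorem circleMean_setLIntegral_ball_le {F : ℂ → ℝ≥0∞} (hF : IsSubharmonicOnDisc F) {z : ℂ}
    {ε : ℝ} (hε : 0 ≤ ε) (h : ‖z‖ + ε < 1) :
    circleMean (fun c => ∫⁻ w in Metric.ball c ε, F w ∂areaMeasure) z ≤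
      ENNReal.ofReal ε ^ 2 * circleMean F ((‖z‖ + ε : ℝ) : ℂ) := by
  have hball : ∀ w ∈ Metric.ball (0 : ℂ) ε, ‖z + w‖ ≤ ‖z‖ + ε := fun w hw => by
    rw [Metric.mem_ball, dist_zero_right] at hw
    linarith [norm_add_le z w]
  have hcont : ContinuousOn (fun q : AddCircle (2 * π) × ℂ => F ((z + q.2) * circlePoint q.1))
      (univ ×ˢ Metric.ball 0 ε) := by
    refine hF.continuousOn.comp (by fun_prop) fun q hq => ?_
    rw [mem_unitDisc, norm_mul_circlePoint]
    exact (hball _ hq.2).trans_lt h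
  have hsf : SFinite areaMeasure := by rw [areaMeasure]; infer_instance
  calc circleMean (fun c => ∫⁻ w in Metric.ball c ε, F w ∂areaMeasure) z
      = ∫⁻ t, ∫⁻ w in Metric.ball (0 : ℂ) ε, F ((z + w) * circlePoint t) ∂areaMeasure
          ∂AddCircle.haarAddCircle := by
        refine lintegral_congr fun t => ?_
        beta_reduce
        rw [← setLIntegral_ball_add_left F,
          ← setLIntegral_ball_mul_circlePoint (fun w => F (z * circlePoint t + w)) t]
        simp only [add_mul]
    _ = ∫⁻ w in Metric.ball (0 : ℂ) ε, circleMean F (z + w) ∂areaMeasure := by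
        rw [lintegral_lintegral_swap]
        · rfl
        · have := hcont.aemeasurable (μ := AddCircle.haarAddCircle.prod areaMeasure)
            (MeasurableSet.univ.prod measurableSet_ball)
          rwa [← Measure.prod_restrict, Measure.restrict_univ] at this
    _ ≤ ∫⁻ w in Metric.ball (0 : ℂ) ε, circleMean F ((‖z‖ + ε : ℝ) : ℂ) ∂areaMeasure := by
        refine setLIntegral_mono' measurableSet_ball fun w hw => ?_
        have hn : ‖((‖z‖ + ε : ℝ) : ℂ)‖ = ‖z‖ + ε := by
          rw [Complex.norm_real, Real.norm_of_nonneg (by positivity)]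
        exact circleMean_le_circleMean hF (by rw [hn]; exact hball w hw) (by rwa [hn])
    _ = _ := by rw [setLIntegral_const, areaMeasure_ball, mul_comm]

/-! ### Integral means of derivatives. -/

/-- The factor in front of `a ^ p` must come arbitrarily close to `1`, so that it can later be
absorbed by the decay of the tails. Either `b` is a small multiple of `a`, or `a` is bounded by a
multiple of `b`. -/
theorem exists_add_rpow_le {p η : ℝ} (hp : 0 < p) (hη : 1 < η) :
    ∃ C : ℝ≥0, ∀ a b : ℝ≥0∞, (a + b) ^ p ≤ ENNReal.ofReal η * a ^ p + C * b ^ p := by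
  set τ := η ^ p⁻¹ - 1 with hτ
  have h1 : 1 < η ^ p⁻¹ := Real.one_lt_rpow hη (inv_pos.2 hp)
  have hτ0 : 0 < τ := by linarith
  refine ⟨((τ⁻¹ + 1) ^ p).toNNReal, fun a b => ?_⟩
  have hcoe : (((τ⁻¹ + 1) ^ p).toNNReal : ℝ≥0∞) = ENNReal.ofReal ((τ⁻¹ + 1) ^ p) := rfl
  rw [hcoe, ← ENNReal.ofReal_rpow_of_pos (by positivity)]
  rcases le_total b (ENNReal.ofReal τ * a) with h | h
  · refine le_add_right ?_
    have h2 : a + b ≤ ENNReal.ofReal (η ^ p⁻¹) * a := by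
      calc a + b ≤ a + ENNReal.ofReal τ * a := by gcongr
        _ = ENNReal.ofReal (η ^ p⁻¹) * a := by
          rw [show η ^ p⁻¹ = 1 + τ by rw [hτ]; ring, ENNReal.ofReal_add zero_le_one hτ0.le,
            ENNReal.ofReal_one]
          ring
    refine (ENNReal.rpow_le_rpow h2 hp.le).trans (le_of_eq ?_)
    rw [ENNReal.mul_rpow_of_nonneg _ _ hp.le, ENNReal.ofReal_rpow_of_pos (by positivity),
      ← Real.rpow_mul (by linarith), inv_mul_cancel₀ hp.ne', Real.rpow_one]
  · refine le_add_left ?_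
    rw [← ENNReal.mul_rpow_of_nonneg _ _ hp.le]
    refine ENNReal.rpow_le_rpow ?_ hp.le
    have h2 : a ≤ ENNReal.ofReal τ⁻¹ * b := by
      calc a = ENNReal.ofReal τ⁻¹ * (ENNReal.ofReal τ * a) := by
            rw [← mul_assoc, ← ENNReal.ofReal_mul (by positivity), inv_mul_cancel₀ hτ0.ne']
            simp
        _ ≤ _ := by gcongr
    calc a + b ≤ ENNReal.ofReal τ⁻¹ * b + b := by gcongr
      _ = _ := by rw [ENNReal.ofReal_add (by positivity) zero_le_one, ENNReal.ofReal_one]; ring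

theorem AnalyticOnNhd.analyticOnNhd_iteratedDeriv {f : ℂ → ℂ} {s : Set ℂ}
    (hf : AnalyticOnNhd ℂ f s) (k : ℕ) : AnalyticOnNhd ℂ (iteratedDeriv k f) s := by
  rw [iteratedDeriv_eq_iterate]
  exact hf.iterated_deriv k

/-- Cauchy's estimate bounds the derivative by `|f v|` at a maximum point `v` of the circle of
radius `δ`. The submean value property on the disc of radius `δ` about `v` then applies for every `p
> 0`. -/
theorem enorm_iteratedDeriv_rpow_mul_le {f : ℂ → ℂ} (hf : AnalyticOnNhd ℂ f unitDisc) {p : ℝ}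
    (hp : 0 < p) (k : ℕ) {z : ℂ} {δ : ℝ} (hδ : 0 < δ) (h : ‖z‖ + 2 * δ < 1) :
    ‖iteratedDeriv k f z‖ₑ ^ p * ENNReal.ofReal δ ^ 2 ≤
      ENNReal.ofReal ((k.factorial / δ ^ k) ^ p) *
        ∫⁻ w in Metric.ball z (2 * δ), ‖f w‖ₑ ^ p ∂areaMeasure := by
  have hball : Metric.closedBall z δ ⊆ unitDisc := fun w hw => by
    rw [Metric.mem_closedBall, dist_eq_norm] at hw
    rw [mem_unitDisc]
    linarith [norm_le_norm_add_norm_sub' w z]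
  have hsub : Metric.sphere z δ ⊆ unitDisc := Metric.sphere_subset_closedBall.trans hball
  obtain ⟨v, hv, hmax⟩ := (isCompact_sphere z δ).exists_isMaxOn
    (NormedSpace.sphere_nonempty.2 hδ.le) (hf.continuousOn.norm.mono hsub)
  have hd : DiffContOnCl ℂ f (Metric.ball z δ) :=
    (hf.differentiableOn.mono (by rwa [closure_ball z hδ.ne'])).diffContOnCl
  have hC := Complex.norm_iteratedDeriv_le_of_forall_mem_sphere_norm_le k hδ hd fun w hw => hmax hw
  have hv' : ‖v - z‖ ≤ δ := by rw [← dist_eq_norm, Metric.mem_sphere.1 hv]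
  have hI := (isSubharmonicOnDisc_enorm_rpow hf hp).mul_le_setLIntegral_larger_ball (δ := δ) hv'
    (by linarith)
  rw [← two_mul] at hI
  have hE : ‖iteratedDeriv k f z‖ₑ ≤ ENNReal.ofReal (k.factorial / δ ^ k) * ‖f v‖ₑ := by
    rw [← ofReal_norm, ← ofReal_norm, ← ENNReal.ofReal_mul (by positivity)]
    refine ENNReal.ofReal_le_ofReal (hC.trans (le_of_eq ?_))
    ring
  calc _ ≤ (ENNReal.ofReal (k.factorial / δ ^ k) * ‖f v‖ₑ) ^ p * ENNReal.ofReal δ ^ 2 := by gcongr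
    _ = ENNReal.ofReal ((k.factorial / δ ^ k) ^ p) * (‖f v‖ₑ ^ p * ENNReal.ofReal δ ^ 2) := by
      rw [ENNReal.mul_rpow_of_nonneg _ _ hp.le, ENNReal.ofReal_rpow_of_nonneg (by positivity) hp.le,
        mul_assoc]
    _ ≤ _ := by gcongr

/-- The `p`-th power of the integral mean of order `p` of `f^{(k)}` over the circle of radius `r`. -/
noncomputable def derivMean (p : ℝ) (f : ℂ → ℂ) (k : ℕ) (r : ℝ) : ℝ≥0∞ :=
  circleMean (fun z => ‖iteratedDeriv k f z‖ₑ ^ p) r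

section derivMean

variable {f : ℂ → ℂ} {p : ℝ}

theorem derivMean_mono (hf : AnalyticOnNhd ℂ f unitDisc) (hp : 0 < p) (k : ℕ) {r s : ℝ}
    (hr : 0 ≤ r) (hrs : r ≤ s) (hs : s < 1) : derivMean p f k r ≤ derivMean p f k s := by
  refine circleMean_le_circleMean (isSubharmonicOnDisc_enorm_rpow
    (hf.analyticOnNhd_iteratedDeriv k) hp) ?_ ?_ <;>
  simp only [Complex.norm_real, Real.norm_of_nonneg hr, Real.norm_of_nonneg (hr.trans hrs)]
  all_goals assumption

theorem derivMean_zero (k : ℕ) : derivMean p f k 0 = ‖iteratedDeriv k f 0‖ₑ ^ p := by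
  simp [derivMean, circleMean_zero]

/-- Cauchy's estimate for integral means. -/
theorem derivMean_le_derivMean_zero (hf : AnalyticOnNhd ℂ f unitDisc) (hp : 0 < p) (k : ℕ) {r δ : ℝ}
    (hr : 0 ≤ r) (hδ : 0 < δ) (h : r + 2 * δ < 1) :
    derivMean p f k r ≤
      ENNReal.ofReal (4 * (k.factorial / δ ^ k) ^ p) * derivMean p f 0 (r + 2 * δ) := by
  have hn : ‖(r : ℂ)‖ = r := by rw [Complex.norm_real, Real.norm_of_nonneg hr]
  have h1 : circleMean (fun z => ENNReal.ofReal δ ^ 2 * ‖iteratedDeriv k f z‖ₑ ^ p) r ≤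
      circleMean (fun z => ENNReal.ofReal ((k.factorial / δ ^ k) ^ p) *
        ∫⁻ w in Metric.ball z (2 * δ), ‖f w‖ₑ ^ p ∂areaMeasure) r := by
    refine circleMean_mono fun z hz => ?_
    rw [mul_comm]
    exact enorm_iteratedDeriv_rpow_mul_le hf hp k hδ (by rwa [hz, hn])
  rw [circleMean_const_mul _ _ (by simp), circleMean_const_mul _ _ (by simp)] at h1
  have h2 := circleMean_setLIntegral_ball_le (isSubharmonicOnDisc_enorm_rpow hf hp) (z := r)
    (ε := 2 * δ) (by positivity) (by rwa [hn])
  rw [hn] at h2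
  have hδ0 : ENNReal.ofReal δ ^ 2 ≠ 0 := by simpa using hδ
  have hδt : ENNReal.ofReal δ ^ 2 ≠ ∞ := by simp
  -- The factor `4` is the ratio `(2δ)² / δ²` of the disc areas.
  rw [← ENNReal.mul_le_mul_iff_right hδ0 hδt]
  refine h1.trans ((mul_le_mul_right h2 _).trans (le_of_eq ?_))
  rw [ENNReal.ofReal_mul (by norm_num : (0 : ℝ) ≤ 4), ENNReal.ofReal_mul (by norm_num : (0 : ℝ) ≤ 2)]
  simp only [derivMean, iteratedDeriv_zero, ENNReal.ofReal_ofNat]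
  ring

/-- The maximum of the derivative is recorded at a point `v`, where subharmonicity of the
derivative's power can be used. -/
theorem exists_enorm_sub_le {f : ℂ → ℂ} (hf : AnalyticOnNhd ℂ f unitDisc) {z w : ℂ}
    (hz : z ∈ unitDisc) (hw : w ∈ unitDisc) :
    ∃ v ∈ segment ℝ z w, ‖f w - f z‖ₑ ≤ ‖deriv f v‖ₑ * ‖w - z‖ₑ := by
  have hconv : Convex ℝ unitDisc := convex_ball _ _
  have hseg : segment ℝ z w ⊆ unitDisc := hconv.segment_subset hz hw
  have hcomp : IsCompact (segment ℝ z w) := by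
    rw [segment_eq_image]
    exact isCompact_Icc.image (by fun_prop)
  obtain ⟨v, hv, hmax⟩ := hcomp.exists_isMaxOn ⟨z, left_mem_segment ℝ z w⟩
    (hf.deriv.continuousOn.norm.mono hseg)
  refine ⟨v, hv, ?_⟩
  have := (convex_segment z w).norm_image_sub_le_of_norm_deriv_le (𝕜 := ℂ)
    (fun x hx => (hf x (hseg hx)).differentiableAt) (fun x hx => hmax hx)
    (left_mem_segment ℝ z w) (right_mem_segment ℝ z w)
  rw [← ofReal_norm, ← ofReal_norm, ← ofReal_norm, ← ENNReal.ofReal_mul (norm_nonneg _)]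
  exact ENNReal.ofReal_le_ofReal this

/-- Moving radially outward by `ε` changes `g = f^{(k)}` by at most `ε |g'(v)|` with `v` on the
radial segment. The value at `v` is replaced by an average over a disc about the starting point, so
that averaging over the circle becomes possible; this costs the extra `δ` in the radius. -/
theorem derivMean_add_le (hf : AnalyticOnNhd ℂ f unitDisc) (hp : 0 < p) {η : ℝ} {C : ℝ≥0}
    (hC : ∀ a b : ℝ≥0∞, (a + b) ^ p ≤ ENNReal.ofReal η * a ^ p + C * b ^ p) (k : ℕ) {r ε δ : ℝ}
    (hr : 0 ≤ r) (hε : 0 ≤ ε) (hδ : 0 < δ) (h : r + (ε + δ) < 1) :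
    derivMean p f k (r + ε) ≤ ENNReal.ofReal η * derivMean p f k r +
      C * ENNReal.ofReal (ε ^ p * ((ε + δ) / δ) ^ 2) * derivMean p f (k + 1) (r + (ε + δ)) := by
  set g := iteratedDeriv k f with hg
  have hga : AnalyticOnNhd ℂ g unitDisc := hf.analyticOnNhd_iteratedDeriv k
  have hg' : iteratedDeriv (k + 1) f = deriv g := iteratedDeriv_succ
  have hsub := isSubharmonicOnDisc_enorm_rpow hga.deriv hp
  set I : ℂ → ℝ≥0∞ := fun z => ∫⁻ w in Metric.ball z (ε + δ), ‖deriv g w‖ₑ ^ p ∂areaMeasure with hI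
  have hδ0 : ENNReal.ofReal δ ^ 2 ≠ 0 := by simpa using hδ
  have hδt : ENNReal.ofReal δ ^ 2 ≠ ∞ := by simp
  have hptz : ∀ t, ‖g ((r + ε : ℝ) * circlePoint t)‖ₑ ^ p ≤
      ENNReal.ofReal η * ‖g (r * circlePoint t)‖ₑ ^ p +
        (C * ENNReal.ofReal (ε ^ p) * (ENNReal.ofReal δ ^ 2)⁻¹) * I (r * circlePoint t) := by
    intro t
    set z := (r : ℂ) * circlePoint t
    set w := ((r + ε : ℝ) : ℂ) * circlePoint t
    have hzn : ‖z‖ = r := by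
      rw [norm_mul_circlePoint, Complex.norm_real, Real.norm_of_nonneg hr]
    have hwn : ‖w‖ = r + ε := by
      rw [norm_mul_circlePoint, Complex.norm_real, Real.norm_of_nonneg (by positivity)]
    have hwz : ‖w - z‖ = ε := by
      have : w - z = (ε : ℂ) * circlePoint t := by simp only [w, z]; push_cast; ring
      rw [this, norm_mul_circlePoint, Complex.norm_real, Real.norm_of_nonneg hε]
    obtain ⟨v, hv, hvle⟩ := exists_enorm_sub_le hga (mem_unitDisc.2 (show ‖z‖ < 1 by linarith))
      (mem_unitDisc.2 (show ‖w‖ < 1 by linarith))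
    have hvz : ‖v - z‖ ≤ ε := by
      rw [← hwz]
      have := norm_sub_le_of_mem_segment hv
      rwa [norm_sub_rev w z, norm_sub_rev v z] at *
    have hb := hsub.mul_le_setLIntegral_larger_ball hvz (δ := δ) (by linarith)
    have hb' : ‖deriv g v‖ₑ ^ p ≤ (ENNReal.ofReal δ ^ 2)⁻¹ * I z := by
      rw [mul_comm, ← div_eq_mul_inv, ENNReal.le_div_iff_mul_le (Or.inl hδ0) (Or.inl hδt)]
      exact hb
    have hεe : ‖w - z‖ₑ = ENNReal.ofReal ε := by rw [← ofReal_norm, hwz]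
    calc ‖g w‖ₑ ^ p ≤ (‖g z‖ₑ + ‖g w - g z‖ₑ) ^ p := by
          refine ENNReal.rpow_le_rpow ?_ hp.le
          calc ‖g w‖ₑ = ‖g z + (g w - g z)‖ₑ := by rw [add_sub_cancel]
            _ ≤ _ := enorm_add_le _ _
      _ ≤ ENNReal.ofReal η * ‖g z‖ₑ ^ p + C * ‖g w - g z‖ₑ ^ p := hC _ _
      _ ≤ ENNReal.ofReal η * ‖g z‖ₑ ^ p + C * (‖deriv g v‖ₑ * ‖w - z‖ₑ) ^ p := by gcongr
      _ = ENNReal.ofReal η * ‖g z‖ₑ ^ p + C * ENNReal.ofReal (ε ^ p) * ‖deriv g v‖ₑ ^ p := by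
          rw [hεe, ENNReal.mul_rpow_of_nonneg _ _ hp.le, ENNReal.ofReal_rpow_of_nonneg hε hp.le]
          ring
      _ ≤ ENNReal.ofReal η * ‖g z‖ₑ ^ p +
            C * ENNReal.ofReal (ε ^ p) * ((ENNReal.ofReal δ ^ 2)⁻¹ * I z) := by gcongr
      _ = _ := by ring
  have hzn : ‖(r : ℂ)‖ = r := by rw [Complex.norm_real, Real.norm_of_nonneg hr]
  have h2 := circleMean_setLIntegral_ball_le hsub (z := r) (ε := ε + δ) (by positivity)
    (by rwa [hzn])
  rw [hzn] at h2
  have hmeas : Measurable fun t => ENNReal.ofReal η * ‖g (r * circlePoint t)‖ₑ ^ p := by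
    refine Measurable.const_mul (Continuous.measurable ?_) _
    exact continuous_comp_mul_circlePoint
      (isSubharmonicOnDisc_enorm_rpow hga hp).continuousOn (by rw [hzn]; linarith)
  have hfinal := lintegral_mono (μ := AddCircle.haarAddCircle) hptz
  rw [lintegral_add_left hmeas, lintegral_const_mul' _ _ ENNReal.ofReal_ne_top,
    lintegral_const_mul' _ _ (by
      exact ENNReal.mul_ne_top (ENNReal.mul_ne_top ENNReal.coe_ne_top ENNReal.ofReal_ne_top)
        (ENNReal.inv_ne_top.2 hδ0))] at hfinal
  refine hfinal.trans ?_
  simp only [derivMean, hg', ← hg]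
  refine add_le_add le_rfl ((mul_le_mul_right h2 _).trans (le_of_eq ?_))
  have : ENNReal.ofReal (ε ^ p * ((ε + δ) / δ) ^ 2) =
      ENNReal.ofReal (ε ^ p) * (ENNReal.ofReal δ ^ 2)⁻¹ * ENNReal.ofReal (ε + δ) ^ 2 := by
    rw [ENNReal.ofReal_mul (by positivity), ENNReal.ofReal_pow (by positivity),
      ENNReal.ofReal_div_of_pos hδ, div_eq_mul_inv, mul_pow, ENNReal.inv_pow]
    ring
  rw [this]
  ring

end derivMean

/-! ### The weight as a measure on `(0, 1)` and the two norms in polar form. -/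

/-- The measure `ω(r) dr` on `(0, 1)`. -/
noncomputable def radialMeasure (ω : ℝ → ℝ) : Measure ℝ :=
  (volume.restrict (Ioo 0 1)).withDensity fun r => ENNReal.ofReal (ω r)

theorem radialMeasure_compl_Ioo (ω : ℝ → ℝ) : radialMeasure ω (Ioo 0 1)ᶜ = 0 := by
  apply withDensity_absolutelyContinuous
  rw [Measure.restrict_apply measurableSet_Ioo.compl]
  simp

namespace IsRadialWeight

variable {ω : ℝ → ℝ}

theorem aemeasurable (hω : IsRadialWeight ω) :
    AEMeasurable (fun r => ENNReal.ofReal (ω r)) (volume.restrict (Ioo 0 1)) :=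
  ((hω.integrableOn.mono_set Ioo_subset_Ico_self).aestronglyMeasurable.aemeasurable).ennreal_ofReal

theorem radialMeasure_Ici (hω : IsRadialWeight ω) {r : ℝ} (hr : 0 ≤ r) (hr1 : r ≤ 1) :
    radialMeasure ω (Ici r) = ENNReal.ofReal (tailIntegral ω r) := by
  rw [radialMeasure, withDensity_apply _ measurableSet_Ici, Measure.restrict_restrict
    measurableSet_Ici, tailIntegral, intervalIntegral.integral_of_le hr1,
    integral_Ioc_eq_integral_Ioo, ofReal_integral_eq_lintegral_ofReal]
  · rw [show Ioo r 1 = Ioi r ∩ Ioo 0 1 from Set.ext fun x =>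
      ⟨fun h => ⟨h.1, hr.trans_lt h.1, h.2⟩, fun h => ⟨h.1, h.2.2⟩⟩]
    exact setLIntegral_congr (ae_eq_set_inter Ioi_ae_eq_Ici.symm (Filter.EventuallyEq.refl _ _))
  · exact hω.integrableOn.mono_set fun x hx => ⟨hr.trans hx.1.le, hx.2⟩
  · filter_upwards [ae_restrict_mem measurableSet_Ioo] with x hx
    exact hω.nonneg x ⟨hr.trans hx.1.le, hx.2⟩

theorem radialMeasure_univ (hω : IsRadialWeight ω) :
    radialMeasure ω univ = ENNReal.ofReal (tailIntegral ω 0) := by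
  rw [← hω.radialMeasure_Ici le_rfl zero_le_one]
  refine le_antisymm ?_ (measure_mono (subset_univ _))
  rw [← union_compl_self (Ioo (0 : ℝ) 1)]
  refine (measure_union_le _ _).trans ?_
  rw [radialMeasure_compl_Ioo, add_zero]
  exact measure_mono fun x hx => hx.1.le

theorem isFiniteMeasure (hω : IsRadialWeight ω) : IsFiniteMeasure (radialMeasure ω) :=
  ⟨by rw [hω.radialMeasure_univ]; exact ENNReal.ofReal_lt_top⟩

theorem tailIntegral_anti (hω : IsRadialWeight ω) {r s : ℝ} (hr : 0 ≤ r) (hrs : r ≤ s)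
    (hs : s ≤ 1) : tailIntegral ω s ≤ tailIntegral ω r := by
  have h1 := hω.radialMeasure_Ici (hr.trans hrs) hs
  have h2 := hω.radialMeasure_Ici hr (hrs.trans hs)
  have h3 : radialMeasure ω (Ici s) ≤ radialMeasure ω (Ici r) := measure_mono (Ici_subset_Ici.2 hrs)
  rw [h1, h2] at h3
  have h0 : 0 ≤ tailIntegral ω r := by
    refine intervalIntegral.integral_nonneg_of_ae_restrict (hrs.trans hs) ?_
    rw [← restrict_Ico_eq_restrict_Icc]
    filter_upwards [ae_restrict_mem measurableSet_Ico] with x hx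
    exact hω.nonneg x ⟨hr.trans hx.1, hx.2⟩
  exact (ENNReal.ofReal_le_ofReal_iff h0).1 h3

theorem lintegral_radialMeasure (hω : IsRadialWeight ω) (G : ℝ → ℝ≥0∞) :
    ∫⁻ r, G r ∂radialMeasure ω = ∫⁻ r in Ioo 0 1, G r * ENNReal.ofReal (ω r) := by
  rw [radialMeasure, lintegral_withDensity_eq_lintegral_mul_non_measurable₀ _ hω.aemeasurable
    (Filter.Eventually.of_forall fun _ => ENNReal.ofReal_lt_top)]
  simp only [Pi.mul_apply, mul_comm]

theorem setLIntegral_unitDisc (hω : IsRadialWeight ω) {F : ℂ → ℝ≥0∞}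
    (hF : ContinuousOn F unitDisc) :
    ∫⁻ z in unitDisc, F z * ENNReal.ofReal (ω ‖z‖) ∂areaMeasure =
      ∫⁻ r, 2 * ENNReal.ofReal r * circleMean F r ∂radialMeasure ω := by
  rw [hω.lintegral_radialMeasure]
  exact setLIntegral_ball_mul_radial hF hω.aemeasurable

theorem bergmanNormPow_eq (hω : IsRadialWeight ω) {f : ℂ → ℂ} (hf : AnalyticOnNhd ℂ f unitDisc)
    {p : ℝ} (hp : 0 < p) :
    bergmanNormPow ω p f = ∫⁻ r, 2 * ENNReal.ofReal r * derivMean p f 0 r ∂radialMeasure ω := by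
  rw [bergmanNormPow, hω.setLIntegral_unitDisc (isSubharmonicOnDisc_enorm_rpow hf hp).continuousOn]
  simp only [derivMean, iteratedDeriv_zero]

theorem derivativeNormPow_eq (hω : IsRadialWeight ω) {f : ℂ → ℂ}
    (hf : AnalyticOnNhd ℂ f unitDisc) {p : ℝ} (hp : 0 < p) (k : ℕ) :
    derivativeNormPow ω p k f = (∫⁻ r, 2 * ENNReal.ofReal r *
      (derivMean p f k r * ENNReal.ofReal ((1 - r) ^ (k * p))) ∂radialMeasure ω) +
      ∑ j ∈ Finset.range k, ‖iteratedDeriv j f 0‖ₑ ^ p := by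
  rw [derivativeNormPow, hω.setLIntegral_unitDisc]
  · congr 1
    refine lintegral_congr_ae ?_
    have : ∀ᵐ r ∂radialMeasure ω, r ∈ Ioo (0 : ℝ) 1 := radialMeasure_compl_Ioo ω
    filter_upwards [this] with r hr
    have h := circleMean_mul_norm (fun z => ‖iteratedDeriv k f z‖ₑ ^ p)
      (fun s => ENNReal.ofReal ((1 - s) ^ (k * p))) r ENNReal.ofReal_ne_top
    rw [h, Complex.norm_real, Real.norm_of_nonneg hr.1.le, derivMean]
  · have h1 := (isSubharmonicOnDisc_enorm_rpow (hf.analyticOnNhd_iteratedDeriv k) hp)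
    refine h1.continuousOn.ennreal_mul ?_ (fun z _ => Or.inr ENNReal.ofReal_ne_top)
      (fun z hz => Or.inr (h1.ne_top z hz))
    refine ENNReal.continuous_ofReal.comp_continuousOn ?_
    exact (continuous_const.sub continuous_norm).continuousOn.rpow_const fun z _ =>
      Or.inr (by positivity)

end IsRadialWeight

/-! ### Two-sided doubling along geometric radii. -/

theorem tailIntegral_le_iterate {ω : ℝ → ℝ} {C : ℝ} (hC : 0 ≤ C)
    (h : ∀ r ∈ Ico (0 : ℝ) 1, tailIntegral ω r ≤ C * tailIntegral ω ((1 + r) / 2)) (m : ℕ) :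
    ∀ r ∈ Ico (0 : ℝ) 1, tailIntegral ω r ≤ C ^ m * tailIntegral ω (1 - (1 - r) / 2 ^ m) := by
  induction m with
  | zero => intro r _; simp
  | succ m ih =>
    intro r hr
    refine (h r hr).trans ?_
    have h1 := ih ((1 + r) / 2) ⟨by linarith [hr.1], by linarith [hr.2]⟩
    have h2 : 1 - (1 - (1 + r) / 2) / 2 ^ m = 1 - (1 - r) / 2 ^ (m + 1) := by
      rw [pow_succ]; field_simp; ring
    rw [h2] at h1
    calc C * tailIntegral ω ((1 + r) / 2) ≤ C * (C ^ m * _) := mul_le_mul_of_nonneg_left h1 hC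
      _ = _ := by ring

/-- Radii approaching `1` geometrically with ratio `κ`. -/
def geomRadius (κ : ℝ) (n : ℕ) : ℝ := 1 - κ ^ n

/-- Two-sided doubling of a measure on `(0, 1)` along geometric radii. -/
structure GeometricDoubling (ν : Measure ℝ) (κ q : ℝ) (D : ℝ≥0) : Prop where
  pos : 0 < κ
  le_half : κ ≤ 1 / 2
  q_pos : 0 < q
  q_lt_one : q < 1
  compl_Ioo : ν (Ioo 0 1)ᶜ = 0
  ne_zero : ν (Ici 0) ≠ 0
  ne_top : ν (Ici 0) ≠ ∞
  le_succ : ∀ n, ν (Ici (geomRadius κ n)) ≤ D * ν (Ici (geomRadius κ (n + 1)))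
  succ_le : ∀ n, ν (Ici (geomRadius κ (n + 1))) ≤ ENNReal.ofReal q * ν (Ici (geomRadius κ n))
  le_block : ∀ n, ν (Ici (geomRadius κ n)) ≤ D * ν (Ico (geomRadius κ n) (geomRadius κ (n + 1)))

theorem IsRadialWeight.exists_geometricDoubling {ω : ℝ → ℝ} (hω : IsRadialWeight ω)
    (h : IsTwoSidedDoubling ω) : ∃ κ q D, GeometricDoubling (radialMeasure ω) κ q D := by
  obtain ⟨⟨C, hC1, hC⟩, K, c, hK, hc, hcK⟩ := h
  -- `κ ≤ K⁻¹` lets one step of ratio `κ` inherit lower doubling; `κ ≤ 1 / 2` keeps the radii from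
  -- `n = 1` on at least `1 / 2`.
  set κ := min K⁻¹ (1 / 2) with hκ
  have hκ0 : 0 < κ := lt_min (by positivity) (by norm_num)
  have hκh : κ ≤ 1 / 2 := min_le_right _ _
  have hκ1 : κ < 1 := by linarith
  have hκK : κ ≤ K⁻¹ := min_le_left _ _
  have hmem : ∀ n, geomRadius κ n ∈ Ico (0 : ℝ) 1 := fun n =>
    ⟨sub_nonneg.2 (pow_le_one₀ hκ0.le hκ1.le), by
      rw [geomRadius]; linarith [pow_pos hκ0 n]⟩
  have hmono : ∀ n, geomRadius κ n ≤ geomRadius κ (n + 1) := fun n => by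
    rw [geomRadius, geomRadius, pow_succ]
    nlinarith [pow_pos hκ0 n]
  set T : ℕ → ℝ := fun n => tailIntegral ω (geomRadius κ n) with hT
  have hTpos : ∀ n, 0 < T n := fun n => hω.tail_pos _ (hmem n)
  have hv : ∀ n, radialMeasure ω (Ici (geomRadius κ n)) = ENNReal.ofReal (T n) := fun n =>
    hω.radialMeasure_Ici (hmem n).1 (hmem n).2.le
  -- `m` halvings of the distance to `1` go past one step of ratio `κ`.
  obtain ⟨m, hm⟩ := pow_unbounded_of_one_lt κ⁻¹ one_lt_two
  have hup : ∀ n, T n ≤ C ^ m * T (n + 1) := fun n => by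
    refine (tailIntegral_le_iterate (by linarith) hC m _ (hmem n)).trans ?_
    refine mul_le_mul_of_nonneg_left ?_ (by positivity)
    refine hω.tailIntegral_anti (hmem _).1 ?_ ?_
    · simp only [geomRadius, pow_succ, sub_sub_cancel]
      have : (2 ^ m)⁻¹ ≤ κ := inv_le_of_inv_le₀ hκ0 hm.le
      rw [div_eq_mul_inv]
      linarith [mul_le_mul_of_nonneg_left this (pow_pos hκ0 n).le]
    · simp only [geomRadius, sub_sub_cancel]
      have : 0 < κ ^ n / 2 ^ m := div_pos (pow_pos hκ0 n) (by positivity)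
      linarith
  have hdown : ∀ n, c * T (n + 1) ≤ T n := fun n => by
    refine le_trans ?_ (hcK _ (hmem n))
    refine mul_le_mul_of_nonneg_left ?_ (by linarith)
    have h1 : (1 - (1 - (1 - κ ^ n)) / K) = 1 - κ ^ n * K⁻¹ := by rw [sub_sub_cancel, div_eq_mul_inv]
    refine hω.tailIntegral_anti ?_ ?_ (hmem _).2.le
    · rw [geomRadius, h1]
      have : κ ^ n * K⁻¹ ≤ 1 * 1 := mul_le_mul (pow_le_one₀ hκ0.le hκ1.le)
        (inv_le_one_of_one_le₀ hK.le) (by positivity) zero_le_one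
      linarith
    · rw [geomRadius, geomRadius, h1, pow_succ]
      linarith [mul_le_mul_of_nonneg_left hκK (pow_pos hκ0 n).le]
  have hc1 : 0 < c - 1 := by linarith
  refine ⟨κ, c⁻¹, (max (C ^ m) (1 + (c - 1)⁻¹)).toNNReal, ?_⟩
  refine ⟨hκ0, hκh, by positivity, inv_lt_one_of_one_lt₀ hc, radialMeasure_compl_Ioo ω, ?_, ?_,
    fun n => ?_, fun n => ?_, fun n => ?_⟩
  · rw [hω.radialMeasure_Ici le_rfl zero_le_one]
    simpa using hω.tail_pos 0 (by simp)
  · rw [hω.radialMeasure_Ici le_rfl zero_le_one]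
    exact ENNReal.ofReal_ne_top
  · rw [hv, hv]
    change _ ≤ ENNReal.ofReal _ * _
    rw [← ENNReal.ofReal_mul (by positivity)]
    exact ENNReal.ofReal_le_ofReal ((hup n).trans
      (mul_le_mul_of_nonneg_right (le_max_left _ _) (hTpos _).le))
  · rw [hv, hv, ← ENNReal.ofReal_mul (by positivity)]
    refine ENNReal.ofReal_le_ofReal ?_
    rw [le_inv_mul_iff₀ (by linarith)]
    exact hdown n
  · have hdiff : Ico (geomRadius κ n) (geomRadius κ (n + 1)) =
        Ici (geomRadius κ n) \ Ici (geomRadius κ (n + 1)) := by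
      ext x; simp
    rw [hdiff, measure_sdiff (Ici_subset_Ici.2 (hmono n)) measurableSet_Ici.nullMeasurableSet
      (by rw [hv]; exact ENNReal.ofReal_ne_top), hv, hv]
    change _ ≤ ENNReal.ofReal _ * _
    rw [← ENNReal.ofReal_sub _ (hTpos _).le, ← ENNReal.ofReal_mul (by positivity)]
    refine ENNReal.ofReal_le_ofReal ?_
    have h1 := hdown n
    -- Lower doubling makes the mass lost in one step dominate what is left.
    have h2 : T (n + 1) ≤ (c - 1)⁻¹ * (T n - T (n + 1)) := by
      rw [le_inv_mul_iff₀ hc1]; linarith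
    have h3 : 0 ≤ T n - T (n + 1) := by nlinarith [hTpos (n + 1)]
    calc T n ≤ (1 + (c - 1)⁻¹) * (T n - T (n + 1)) := by linarith
      _ ≤ _ := mul_le_mul_of_nonneg_right (le_max_right _ _) h3

/-! ### Discretized norms: doubling implies the norm equivalence. -/

/-- The sum may be infinite, so `q ∑ a n` cannot be subtracted. Partial sums are instead kept below
the fixed point of `t ↦ X + ∑ b n + q t`. -/
theorem tsum_le_of_le_mul_add {a b : ℕ → ℝ≥0∞} {X : ℝ≥0∞} {q : ℝ} (hq0 : 0 ≤ q) (hq : q < 1)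
    (h0 : a 0 ≤ X + b 0) (h : ∀ n, a (n + 1) ≤ ENNReal.ofReal q * a n + b (n + 1)) :
    ∑' n, a n ≤ ENNReal.ofReal (1 - q)⁻¹ * (X + ∑' n, b n) := by
  set T := ENNReal.ofReal (1 - q)⁻¹ * (X + ∑' n, b n) with hT
  have hq1 : 0 < 1 - q := by linarith
  have hfix : X + ∑' n, b n + ENNReal.ofReal q * T = T := by
    have h1 : X + ∑' n, b n = ENNReal.ofReal (1 - q) * T := by
      rw [hT, ← mul_assoc, ← ENNReal.ofReal_mul hq1.le, mul_inv_cancel₀ hq1.ne', ENNReal.ofReal_one,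
        one_mul]
    rw [h1, ← add_mul, ← ENNReal.ofReal_add hq1.le hq0]
    simp
  refine ENNReal.tsum_le_of_sum_range_le fun N => ?_
  induction N with
  | zero => simp
  | succ N ih =>
    calc ∑ n ∈ Finset.range (N + 1), a n
        = ∑ n ∈ Finset.range N, a (n + 1) + a 0 := Finset.sum_range_succ' _ _
      _ ≤ ∑ n ∈ Finset.range N, (ENNReal.ofReal q * a n + b (n + 1)) + (X + b 0) := by
          gcongr
          exact h _
      _ = X + ∑ n ∈ Finset.range (N + 1), b n + ENNReal.ofReal q * ∑ n ∈ Finset.range N, a n := by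
          rw [Finset.sum_add_distrib, Finset.sum_range_succ' b, Finset.mul_sum]
          ring
      _ ≤ X + ∑' n, b n + ENNReal.ofReal q * T := by
          gcongr
          exact ENNReal.sum_le_tsum _
      _ = T := hfix

/-- Discretization along geometric radii of `∫ M_p^p(r, f^{(j)}) (1 - r)^{jp} dν(r)`. -/
noncomputable def geomSum (ν : Measure ℝ) (κ p : ℝ) (f : ℂ → ℂ) (j : ℕ) : ℝ≥0∞ :=
  ∑' n, derivMean p f j (geomRadius κ (n + 1)) *
    (ENNReal.ofReal ((κ ^ n) ^ (j * p)) * ν (Ici (geomRadius κ n)))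

namespace GeometricDoubling

variable {ν : Measure ℝ} {κ q p : ℝ} {D : ℝ≥0} {f : ℂ → ℂ}

theorem lt_one (h : GeometricDoubling ν κ q D) : κ < 1 := by linarith [h.le_half]

theorem geomRadius_nonneg (h : GeometricDoubling ν κ q D) (n : ℕ) : 0 ≤ geomRadius κ n :=
  sub_nonneg.2 (pow_le_one₀ h.pos.le h.lt_one.le)

theorem geomRadius_lt_one (h : GeometricDoubling ν κ q D) (n : ℕ) : geomRadius κ n < 1 := by
  rw [geomRadius]; linarith [pow_pos h.pos n]

theorem geomRadius_mono (h : GeometricDoubling ν κ q D) : Monotone (geomRadius κ) :=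
  monotone_nat_of_le_succ fun n =>
    sub_le_sub_left (pow_le_pow_of_le_one h.pos.le h.lt_one.le n.le_succ) 1

theorem half_le_geomRadius (h : GeometricDoubling ν κ q D) (n : ℕ) :
    1 / 2 ≤ geomRadius κ (n + 1) := by
  refine le_trans ?_ (h.geomRadius_mono (Nat.succ_le_succ (Nat.zero_le n)))
  rw [geomRadius, pow_one]
  linarith [h.le_half]

theorem tendsto_geomRadius (h : GeometricDoubling ν κ q D) :
    Filter.Tendsto (geomRadius κ) Filter.atTop (𝓝 1) := by
  have := (tendsto_pow_atTop_nhds_zero_of_lt_one h.pos.le h.lt_one).const_sub 1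
  rwa [sub_zero] at this

theorem ae_mem_Ioo (h : GeometricDoubling ν κ q D) : ∀ᵐ r ∂ν, r ∈ Ioo (0 : ℝ) 1 := h.compl_Ioo

theorem pairwise_disjoint (h : GeometricDoubling ν κ q D) :
    Pairwise (Function.onFun Disjoint fun n => Ico (geomRadius κ n) (geomRadius κ (n + 1))) := by
  have := h.geomRadius_mono.pairwise_disjoint_on_Ico_succ
  simpa using this

theorem lintegral_le_tsum (h : GeometricDoubling ν κ q D) {G : ℝ → ℝ≥0∞} {B : ℕ → ℝ≥0∞}
    (hGB : ∀ n, ∀ r ∈ Ico (geomRadius κ n) (geomRadius κ (n + 1)), G r ≤ B n) :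
    ∫⁻ r, G r ∂ν ≤ ∑' n, B n * ν (Ici (geomRadius κ n)) := by
  have hcover : Ioo (0 : ℝ) 1 ⊆ ⋃ n, Ico (geomRadius κ n) (geomRadius κ (n + 1)) := by
    intro r hr
    have hex : ∃ n, r < geomRadius κ n := (h.tendsto_geomRadius.eventually (lt_mem_nhds hr.2)).exists
    classical
    have hne : Nat.find hex ≠ 0 := fun h0 => by
      have := Nat.find_spec hex
      rw [h0, geomRadius, pow_zero, sub_self] at this
      exact this.not_gt hr.1
    obtain ⟨n, hn⟩ := Nat.exists_eq_succ_of_ne_zero hne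
    refine mem_iUnion.2 ⟨n, not_lt.1 (Nat.find_min hex (by omega)), ?_⟩
    have := Nat.find_spec hex
    rwa [hn] at this
  calc ∫⁻ r, G r ∂ν = ∫⁻ r in Ioo 0 1, G r ∂ν := by
        rw [Measure.restrict_eq_self_of_ae_mem h.ae_mem_Ioo]
    _ ≤ ∫⁻ r in ⋃ n, Ico (geomRadius κ n) (geomRadius κ (n + 1)), G r ∂ν := lintegral_mono_set hcover
    _ ≤ ∑' n, ∫⁻ r in Ico (geomRadius κ n) (geomRadius κ (n + 1)), G r ∂ν := lintegral_iUnion_le _ _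
    _ ≤ ∑' n, B n * ν (Ici (geomRadius κ n)) := by
        refine ENNReal.tsum_le_tsum fun n => ?_
        refine (setLIntegral_mono' measurableSet_Ico (hGB n)).trans ?_
        rw [setLIntegral_const]
        gcongr
        exact Ico_subset_Ici_self

/-- Lower bounds are only available for radii beyond `r_{n+1}`. One factor `D` moves the tail from
`r_n` to `r_{n+1}`, the other replaces that tail by the disjoint block that follows. -/
theorem tsum_le_lintegral (h : GeometricDoubling ν κ q D) {G : ℝ → ℝ≥0∞} {B : ℕ → ℝ≥0∞}
    (hGB : ∀ n, ∀ r ∈ Ico (geomRadius κ (n + 1)) (geomRadius κ (n + 2)), B n ≤ G r) :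
    ∑' n, B n * ν (Ici (geomRadius κ n)) ≤ (D * D : ℝ≥0) * ∫⁻ r, G r ∂ν := by
  calc ∑' n, B n * ν (Ici (geomRadius κ n))
      ≤ ∑' n, (D * D : ℝ≥0) *
          ∫⁻ r in Ico (geomRadius κ (n + 1)) (geomRadius κ (n + 2)), G r ∂ν := by
        refine ENNReal.tsum_le_tsum fun n => ?_
        calc B n * ν (Ici (geomRadius κ n))
            ≤ B n * (D * (D * ν (Ico (geomRadius κ (n + 1)) (geomRadius κ (n + 2))))) := by
              gcongr
              refine (h.le_succ n).trans ?_
              gcongr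
              exact h.le_block (n + 1)
          _ = (D * D : ℝ≥0) * (B n * ν (Ico (geomRadius κ (n + 1)) (geomRadius κ (n + 2)))) := by
              rw [ENNReal.coe_mul]; ring
          _ ≤ _ := by
              gcongr
              rw [← setLIntegral_const]
              exact setLIntegral_mono' measurableSet_Ico (hGB n)
    _ = (D * D : ℝ≥0) *
          ∫⁻ r in ⋃ n, Ico (geomRadius κ (n + 1)) (geomRadius κ (n + 2)), G r ∂ν := by
        rw [ENNReal.tsum_mul_left, lintegral_iUnion (fun _ => measurableSet_Ico)]
        intro m n hmn
        exact h.pairwise_disjoint (fun e => hmn (Nat.succ_injective e))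
    _ ≤ _ := by
        gcongr
        exact Measure.restrict_le_self

theorem geomSum_le_lintegral (h : GeometricDoubling ν κ q D)
    (hp : 0 < p) (j : ℕ) : ∃ C : ℝ≥0, ∀ f : ℂ → ℂ, AnalyticOnNhd ℂ f unitDisc →
      geomSum ν κ p f j ≤ C * ∫⁻ r, 2 * ENNReal.ofReal r *
        (derivMean p f j r * ENNReal.ofReal ((1 - r) ^ (j * p))) ∂ν := by
  set E : ℝ := ((κ ^ 2) ^ (j * p))⁻¹ with hE
  have hκ2 : 0 < (κ ^ 2) ^ (j * p) := Real.rpow_pos_of_pos (pow_pos h.pos 2) _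
  refine ⟨E.toNNReal * (D * D), fun f hf => ?_⟩
  have hmain := h.tsum_le_lintegral
    (G := fun r => ENNReal.ofReal E * (2 * ENNReal.ofReal r *
        (derivMean p f j r * ENNReal.ofReal ((1 - r) ^ (j * p)))))
    (B := fun n => derivMean p f j (geomRadius κ (n + 1)) * ENNReal.ofReal ((κ ^ n) ^ (j * p))) ?_
  · rw [lintegral_const_mul' _ _ ENNReal.ofReal_ne_top] at hmain
    rw [geomSum]
    simp only [mul_assoc] at hmain ⊢
    refine hmain.trans (le_of_eq ?_)
    rw [ENNReal.coe_mul E.toNNReal]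
    change _ = ENNReal.ofReal E * _ * _
    ring
  · intro n r hr
    -- Shifting the block away from the origin makes the Jacobian `2 r` at least `1`.
    have hr0 : (1 : ℝ) / 2 ≤ r := (h.half_le_geomRadius n).trans hr.1
    have hr1 : r < 1 := hr.2.trans (h.geomRadius_lt_one _)
    have h2 : (1 : ℝ≥0∞) ≤ 2 * ENNReal.ofReal r := by
      have : (2 : ℝ≥0∞) = ENNReal.ofReal 2 := by simp
      rw [this, ← ENNReal.ofReal_mul (by norm_num), ENNReal.one_le_ofReal]
      linarith
    have hm := derivMean_mono hf hp j (h.geomRadius_nonneg (n + 1)) hr.1 hr1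
    have hk : (κ ^ n) ^ (j * p) ≤ E * (1 - r) ^ (j * p) := by
      rw [hE, le_inv_mul_iff₀ hκ2, ← Real.mul_rpow (by positivity [h.pos]) (by positivity [h.pos])]
      have h3 : κ ^ (n + 2) ≤ 1 - r := by
        have := hr.2
        rw [geomRadius] at this
        linarith
      refine Real.rpow_le_rpow (by have := h.pos; positivity) ?_ (by positivity)
      rw [← pow_add, add_comm]
      exact h3
    calc derivMean p f j (geomRadius κ (n + 1)) * ENNReal.ofReal ((κ ^ n) ^ (j * p))
        ≤ derivMean p f j r * ENNReal.ofReal (E * (1 - r) ^ (j * p)) := by gcongr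
      _ = 1 * (ENNReal.ofReal E * (derivMean p f j r * ENNReal.ofReal ((1 - r) ^ (j * p)))) := by
          rw [ENNReal.ofReal_mul (by rw [hE]; positivity)]
          ring
      _ ≤ (2 * ENNReal.ofReal r) *
            (ENNReal.ofReal E * (derivMean p f j r * ENNReal.ofReal ((1 - r) ^ (j * p)))) := by
          gcongr
      _ = _ := by ring

theorem two_mul_ofReal_le (r : ℝ) (hr : r < 1) : 2 * ENNReal.ofReal r ≤ 2 := by
  have : ENNReal.ofReal r ≤ 1 := ENNReal.ofReal_le_one.2 hr.le
  calc 2 * ENNReal.ofReal r ≤ 2 * 1 := by gcongr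
    _ = 2 := mul_one 2

theorem lintegral_le_geomSum (h : GeometricDoubling ν κ q D) (hp : 0 < p)
    (hf : AnalyticOnNhd ℂ f unitDisc) :
    ∫⁻ r, 2 * ENNReal.ofReal r * derivMean p f 0 r ∂ν ≤ 2 * geomSum ν κ p f 0 := by
  refine (h.lintegral_le_tsum (B := fun n => 2 * derivMean p f 0 (geomRadius κ (n + 1))) ?_).trans ?_
  · intro n r hr
    exact mul_le_mul' (two_mul_ofReal_le r (hr.2.trans (h.geomRadius_lt_one _)))
      (derivMean_mono hf hp 0 ((h.geomRadius_nonneg n).trans hr.1) hr.2.le (h.geomRadius_lt_one _))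
  · rw [geomSum, ← ENNReal.tsum_mul_left]
    refine le_of_eq (tsum_congr fun n => ?_)
    simp [mul_assoc]

theorem lintegral_derivMean_le_geomSum (h : GeometricDoubling ν κ q D) (hp : 0 < p) (k : ℕ) :
    ∃ C : ℝ≥0, ∀ f : ℂ → ℂ, AnalyticOnNhd ℂ f unitDisc →
      ∫⁻ r, 2 * ENNReal.ofReal r * (derivMean p f k r * ENNReal.ofReal ((1 - r) ^ (k * p))) ∂ν ≤
        C * geomSum ν κ p f 0 := by
  have hκ := h.pos
  have hκ1 := h.lt_one
  -- Chosen so that `r_{n+1} + 2 κ^n δ = r_{n+2}`. The powers of `κ^n` from Cauchy's estimate then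
  -- cancel the weight `(1 - r)^{kp} ≤ κ^{nkp}`.
  set δ : ℝ := κ * (1 - κ) / 2 with hδ
  have hδ0 : 0 < δ := by have : 0 < 1 - κ := by linarith
                         positivity
  set E : ℝ := 4 * (k.factorial / δ ^ k) ^ p with hE
  refine ⟨2 * E.toNNReal * D, fun f hf => ?_⟩
  refine (h.lintegral_le_tsum (B := fun n => 2 * (ENNReal.ofReal E *
    derivMean p f 0 (geomRadius κ (n + 2)))) ?_).trans ?_
  · intro n r hr
    have hr0 := (h.geomRadius_nonneg n).trans hr.1
    have hr1 : r < 1 := hr.2.trans (h.geomRadius_lt_one _)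
    refine mul_le_mul' (two_mul_ofReal_le r hr1) ?_
    have hm := derivMean_mono hf hp k hr0 hr.2.le (h.geomRadius_lt_one (n + 1))
    have hkn : 0 < κ ^ n := pow_pos hκ n
    have hrad : geomRadius κ (n + 1) + 2 * (κ ^ n * δ) = geomRadius κ (n + 2) := by
      rw [geomRadius, geomRadius, hδ]; ring
    have hc := derivMean_le_derivMean_zero hf hp k (h.geomRadius_nonneg (n + 1))
      (δ := κ ^ n * δ) (by positivity) (by rw [hrad]; exact h.geomRadius_lt_one _)
    rw [hrad] at hc
    have h1r : (1 - r) ^ (k * p) ≤ ((κ ^ n) ^ k) ^ p := by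
      rw [← Real.rpow_natCast (κ ^ n) k, ← Real.rpow_mul hkn.le]
      refine Real.rpow_le_rpow (by linarith) ?_ (by positivity)
      have := hr.1
      rw [geomRadius] at this
      linarith
    calc derivMean p f k r * ENNReal.ofReal ((1 - r) ^ (k * p))
        ≤ (ENNReal.ofReal (4 * (k.factorial / (κ ^ n * δ) ^ k) ^ p) *
            derivMean p f 0 (geomRadius κ (n + 2))) * ENNReal.ofReal (((κ ^ n) ^ k) ^ p) := by
          gcongr
          exact hm.trans hc
      _ = ENNReal.ofReal ((4 * (k.factorial / (κ ^ n * δ) ^ k) ^ p) * ((κ ^ n) ^ k) ^ p) *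
            derivMean p f 0 (geomRadius κ (n + 2)) := by
          rw [ENNReal.ofReal_mul
            (show 0 ≤ 4 * ((k.factorial : ℝ) / (κ ^ n * δ) ^ k) ^ p by positivity)]
          ring
      _ = _ := by
          congr 2
          rw [hE, mul_assoc, ← Real.mul_rpow (by positivity) (by positivity), mul_pow]
          congr 2
          field_simp
  · calc ∑' n, 2 * (ENNReal.ofReal E * derivMean p f 0 (geomRadius κ (n + 2))) *
          ν (Ici (geomRadius κ n))
        -- One use of upper doubling matches the tail index with the larger radius `r_{n+2}`. The
        -- result is `geomSum` without its first term.
        ≤ ∑' n, (2 * E.toNNReal * D : ℝ≥0) * (derivMean p f 0 (geomRadius κ (n + 2)) *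
          (ENNReal.ofReal ((κ ^ (n + 1)) ^ ((0 : ℕ) * p)) * ν (Ici (geomRadius κ (n + 1))))) := by
          refine ENNReal.tsum_le_tsum fun n => ?_
          have : ((2 * E.toNNReal * D : ℝ≥0) : ℝ≥0∞) = 2 * ENNReal.ofReal E * D := by
            push_cast; rfl
          rw [this]
          calc _ ≤ 2 * (ENNReal.ofReal E * derivMean p f 0 (geomRadius κ (n + 2))) *
                (D * ν (Ici (geomRadius κ (n + 1)))) := by
                gcongr
                exact h.le_succ n
            _ = _ := by simp; ring
      _ ≤ _ := by
          rw [ENNReal.tsum_mul_left, geomSum]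
          refine mul_le_mul' le_rfl ?_
          exact ENNReal.tsum_comp_le_tsum_of_injective (Nat.succ_injective)
            (fun n => derivMean p f 0 (geomRadius κ (n + 1)) *
              (ENNReal.ofReal ((κ ^ n) ^ ((0 : ℕ) * p)) * ν (Ici (geomRadius κ n))))

theorem enorm_iteratedDeriv_zero_le_geomSum (h : GeometricDoubling ν κ q D) (hp : 0 < p) (j : ℕ) :
    ∃ C : ℝ≥0, ∀ f : ℂ → ℂ, AnalyticOnNhd ℂ f unitDisc →
      ‖iteratedDeriv j f 0‖ₑ ^ p ≤ C * geomSum ν κ p f 0 := by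
  set E : ℝ := 4 * (j.factorial / (1 / 4) ^ j) ^ p with hE
  refine ⟨E.toNNReal * (ν (Ici 0))⁻¹.toNNReal, fun f hf => ?_⟩
  have h1 := derivMean_le_derivMean_zero hf hp j (r := 0) (δ := 1 / 4) le_rfl (by norm_num)
    (by norm_num)
  rw [derivMean_zero] at h1
  refine h1.trans ?_
  have h2 : derivMean p f 0 (0 + 2 * (1 / 4)) ≤ derivMean p f 0 (geomRadius κ 1) :=
    derivMean_mono hf hp 0 (by norm_num)
      (by have := h.half_le_geomRadius 0; norm_num at this ⊢; exact this) (h.geomRadius_lt_one 1)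
  have h3 : derivMean p f 0 (geomRadius κ 1) * ν (Ici 0) ≤ geomSum ν κ p f 0 := by
    refine le_trans (le_of_eq ?_) (ENNReal.le_tsum 0)
    simp [geomRadius]
  have h4 : derivMean p f 0 (geomRadius κ 1) ≤ (ν (Ici 0))⁻¹ * geomSum ν κ p f 0 := by
    rw [mul_comm (ν (Ici 0))⁻¹, ← div_eq_mul_inv,
      ENNReal.le_div_iff_mul_le (Or.inl h.ne_zero) (Or.inl h.ne_top)]
    exact h3
  rw [ENNReal.coe_mul, ENNReal.coe_toNNReal (ENNReal.inv_ne_top.2 h.ne_zero), mul_assoc]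
  exact mul_le_mul' le_rfl (h2.trans h4)

/-- A discrete Hardy inequality. Each term of order `j` is at most `q' < 1` times its predecessor
plus a term of order `j + 1`: the mean grows by at most `η` while the weight shrinks by `q`. -/
theorem geomSum_le_geomSum_succ (h : GeometricDoubling ν κ q D) (hp : 0 < p) (j : ℕ) :
    ∃ C : ℝ≥0, ∀ f : ℂ → ℂ, AnalyticOnNhd ℂ f unitDisc →
      geomSum ν κ p f j ≤ C * (‖iteratedDeriv j f 0‖ₑ ^ p + geomSum ν κ p f (j + 1)) := by
  have hκ := h.pos
  have hκ1 := h.lt_one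
  -- With `η = q' / q`, the growth of the mean still leaves the contraction `η q = q' < 1`.
  obtain ⟨q', hqq', hq'1⟩ := exists_between h.q_lt_one
  have hq := h.q_pos
  have hη : 1 < q' / q := (one_lt_div hq).2 hqq'
  obtain ⟨A, hA⟩ := exists_add_rpow_le hp hη
  set η := q' / q with hηdef
  set E : ℝ := (κ⁻¹ + 1) ^ 2 * (κ ^ ((j + 1) * p))⁻¹ with hE
  have hEpos : 0 ≤ E := by positivity
  set V : ℝ≥0∞ := ν (Ici 0) with hV
  set B : ℝ≥0∞ := A * ENNReal.ofReal E * D with hB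
  have hBt : B ≠ ∞ := ENNReal.mul_ne_top (ENNReal.mul_ne_top ENNReal.coe_ne_top
    ENNReal.ofReal_ne_top) ENNReal.coe_ne_top
  set Q : ℝ≥0∞ := ENNReal.ofReal (1 - q')⁻¹ * (ENNReal.ofReal η * V + B) with hQ
  have hQt : Q ≠ ∞ := ENNReal.mul_ne_top ENNReal.ofReal_ne_top
    (ENNReal.add_ne_top.2 ⟨ENNReal.mul_ne_top ENNReal.ofReal_ne_top h.ne_top, hBt⟩)
  refine ⟨Q.toNNReal, fun f hf => ?_⟩
  rw [ENNReal.coe_toNNReal hQt]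
  set w : ℕ → ℕ → ℝ≥0∞ := fun i n => ENNReal.ofReal ((κ ^ n) ^ (i * p)) * ν (Ici (geomRadius κ n))
    with hw
  have hstep : ∀ n, derivMean p f j (geomRadius κ (n + 1)) * w j n ≤
      ENNReal.ofReal η * derivMean p f j (geomRadius κ n) * w j n +
        B * (derivMean p f (j + 1) (geomRadius κ (n + 2)) * w (j + 1) (n + 1)) := by
    intro n
    have hkn : 0 < κ ^ n := pow_pos hκ n
    have h1κ : 0 < 1 - κ := by linarith
    have hr1 : geomRadius κ n + κ ^ n * (1 - κ) = geomRadius κ (n + 1) := by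
      rw [geomRadius, geomRadius]; ring
    have hr2 : geomRadius κ n + (κ ^ n * (1 - κ) + κ ^ (n + 1) * (1 - κ)) =
        geomRadius κ (n + 2) := by
      rw [geomRadius, geomRadius]; ring
    -- The increment `ε` leads from `r_n` to `r_{n+1}` and the margin `δ` on to `r_{n+2}`. The
    -- factor `ε ^ p ≤ (κ^n)^p` supplies the weight of one more derivative.
    have hs := derivMean_add_le hf hp hA j (h.geomRadius_nonneg n) (ε := κ ^ n * (1 - κ))
      (δ := κ ^ (n + 1) * (1 - κ)) (by positivity) (by positivity)
      (by rw [hr2]; exact h.geomRadius_lt_one _)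
    rw [hr1, hr2] at hs
    have hcoef : (κ ^ n * (1 - κ)) ^ p * ((κ ^ n * (1 - κ) + κ ^ (n + 1) * (1 - κ)) /
        (κ ^ (n + 1) * (1 - κ))) ^ 2 ≤ (κ ^ n) ^ p * (κ⁻¹ + 1) ^ 2 := by
      have e1 : (κ ^ n * (1 - κ) + κ ^ (n + 1) * (1 - κ)) / (κ ^ (n + 1) * (1 - κ)) = κ⁻¹ + 1 := by
        rw [pow_succ]; field_simp
      rw [e1]
      gcongr
      nlinarith
    have hwt : ENNReal.ofReal ((κ ^ n) ^ p * (κ⁻¹ + 1) ^ 2) * w j n ≤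
        ENNReal.ofReal E * D * w (j + 1) (n + 1) := by
      have e2 : ((κ ^ n) ^ p * (κ⁻¹ + 1) ^ 2) * (κ ^ n) ^ (j * p) =
          E * (κ ^ (n + 1)) ^ ((j + 1 : ℕ) * p) := by
        rw [hE, pow_succ κ n, Real.mul_rpow hkn.le hκ.le]
        push_cast
        have e3 : (κ ^ n) ^ ((j + 1 : ℝ) * p) = (κ ^ n) ^ (j * p) * (κ ^ n) ^ p := by
          rw [← Real.rpow_add hkn]; ring_nf
        have e4 : κ ^ ((j + 1 : ℝ) * p) ≠ 0 := (Real.rpow_pos_of_pos hκ _).ne'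
        rw [e3]
        field_simp
      simp only [hw]
      rw [← mul_assoc, ← ENNReal.ofReal_mul (by positivity), e2, ENNReal.ofReal_mul hEpos]
      calc _ ≤ ENNReal.ofReal E * ENNReal.ofReal ((κ ^ (n + 1)) ^ ((j + 1 : ℕ) * p)) *
            (D * ν (Ici (geomRadius κ (n + 1)))) := by
            gcongr
            exact h.le_succ n
        _ = _ := by ring
    calc derivMean p f j (geomRadius κ (n + 1)) * w j n
        ≤ (ENNReal.ofReal η * derivMean p f j (geomRadius κ n) +
          A * ENNReal.ofReal ((κ ^ n) ^ p * (κ⁻¹ + 1) ^ 2) *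
            derivMean p f (j + 1) (geomRadius κ (n + 2))) * w j n := by
          refine mul_le_mul' (hs.trans ?_) le_rfl
          gcongr
      _ = ENNReal.ofReal η * derivMean p f j (geomRadius κ n) * w j n +
          A * derivMean p f (j + 1) (geomRadius κ (n + 2)) *
            (ENNReal.ofReal ((κ ^ n) ^ p * (κ⁻¹ + 1) ^ 2) * w j n) := by ring
      _ ≤ ENNReal.ofReal η * derivMean p f j (geomRadius κ n) * w j n +
          A * derivMean p f (j + 1) (geomRadius κ (n + 2)) *
            (ENNReal.ofReal E * D * w (j + 1) (n + 1)) := by gcongr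
      _ = _ := by rw [hB]; ring
  have hwq : ∀ n, w j (n + 1) ≤ ENNReal.ofReal q * w j n := fun n => by
    simp only [hw]
    calc _ ≤ ENNReal.ofReal ((κ ^ n) ^ (j * p)) *
          (ENNReal.ofReal q * ν (Ici (geomRadius κ n))) := by
          refine mul_le_mul' (ENNReal.ofReal_le_ofReal ?_) (h.succ_le n)
          exact Real.rpow_le_rpow (by positivity)
            (pow_le_pow_of_le_one hκ.le hκ1.le n.le_succ) (by positivity)
      _ = _ := by ring
  set b : ℕ → ℝ≥0∞ := fun n =>
    B * (derivMean p f (j + 1) (geomRadius κ (n + 2)) * w (j + 1) (n + 1)) with hb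
  have hsum := tsum_le_of_le_mul_add (a := fun n => derivMean p f j (geomRadius κ (n + 1)) * w j n)
    (b := b) (X := ENNReal.ofReal η * V * ‖iteratedDeriv j f 0‖ₑ ^ p) (q := q') (by linarith) hq'1
    ?_ ?_
  · have hbs : ∑' n, b n ≤ B * geomSum ν κ p f (j + 1) := by
      rw [hb, ENNReal.tsum_mul_left, geomSum]
      refine mul_le_mul' le_rfl ?_
      exact ENNReal.tsum_comp_le_tsum_of_injective (Nat.succ_injective)
        (fun n => derivMean p f (j + 1) (geomRadius κ (n + 1)) * w (j + 1) n)
    refine hsum.trans ?_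
    rw [hQ, mul_assoc (ENNReal.ofReal (1 - q')⁻¹)]
    refine mul_le_mul' le_rfl ?_
    calc _ ≤ ENNReal.ofReal η * V * ‖iteratedDeriv j f 0‖ₑ ^ p + B * geomSum ν κ p f (j + 1) := by
          gcongr
      _ ≤ (ENNReal.ofReal η * V + B) * ‖iteratedDeriv j f 0‖ₑ ^ p +
          (ENNReal.ofReal η * V + B) * geomSum ν κ p f (j + 1) := by
          gcongr
          · exact le_self_add
          · exact le_add_self
      _ = _ := by ring
  -- The recursion starts at `r_0 = 0`, where the mean is the value at the origin.
  · refine (hstep 0).trans (add_le_add (le_of_eq ?_) le_rfl)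
    simp only [hw, geomRadius, pow_zero, sub_self, derivMean_zero, Real.one_rpow,
      ENNReal.ofReal_one, one_mul]
    ring
  · intro n
    refine (hstep (n + 1)).trans (add_le_add ?_ le_rfl)
    calc _ ≤ ENNReal.ofReal η * derivMean p f j (geomRadius κ (n + 1)) *
          (ENNReal.ofReal q * w j n) := by gcongr; exact hwq n
      _ = ENNReal.ofReal (η * q) * (derivMean p f j (geomRadius κ (n + 1)) * w j n) := by
          rw [ENNReal.ofReal_mul (by linarith)]; ring
      _ = _ := by rw [hηdef, div_mul_cancel₀ _ hq.ne']

theorem geomSum_zero_le (h : GeometricDoubling ν κ q D) (hp : 0 < p) (k : ℕ) :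
    ∃ C : ℝ≥0, ∀ f : ℂ → ℂ, AnalyticOnNhd ℂ f unitDisc →
      geomSum ν κ p f 0 ≤
        C * (∑ j ∈ Finset.range k, ‖iteratedDeriv j f 0‖ₑ ^ p + geomSum ν κ p f k) := by
  induction k with
  | zero => exact ⟨1, fun f _ => by simp⟩
  | succ k ih =>
    obtain ⟨C, hC⟩ := ih
    obtain ⟨C', hC'⟩ := h.geomSum_le_geomSum_succ hp k
    refine ⟨C * (1 + C'), fun f hf => (hC f hf).trans ?_⟩
    rw [Finset.sum_range_succ]
    push_cast
    rw [mul_assoc]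
    gcongr
    set S := ∑ j ∈ Finset.range k, ‖iteratedDeriv j f 0‖ₑ ^ p
    set x := ‖iteratedDeriv k f 0‖ₑ ^ p
    calc S + geomSum ν κ p f k ≤ S + C' * (x + geomSum ν κ p f (k + 1)) := by
          gcongr; exact hC' f hf
      _ ≤ (1 + C') * S + (1 + C') * (x + geomSum ν κ p f (k + 1)) := by
          gcongr
          · exact le_mul_of_one_le_left' le_self_add
          · exact le_add_self
      _ = _ := by ring

end GeometricDoubling

theorem exists_norm_equivalence {ω : ℝ → ℝ} (hω : IsRadialWeight ω) {p : ℝ} (hp : 0 < p) (k : ℕ)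
    (h : IsTwoSidedDoubling ω) :
    ∃ C : ℝ≥0, 0 < C ∧ ∀ f : ℂ → ℂ, AnalyticOnNhd ℂ f unitDisc →
      bergmanNormPow ω p f ≤ C * derivativeNormPow ω p k f ∧
      derivativeNormPow ω p k f ≤ C * bergmanNormPow ω p f := by
  obtain ⟨κ, q, D, hG⟩ := hω.exists_geometricDoubling h
  obtain ⟨C₁, h₁⟩ := hG.geomSum_zero_le hp k
  obtain ⟨C₂, h₂⟩ := hG.geomSum_le_lintegral hp k
  obtain ⟨C₃, h₃⟩ := hG.geomSum_le_lintegral hp 0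
  obtain ⟨C₄, h₄⟩ := hG.lintegral_derivMean_le_geomSum hp k
  choose C₅ h₅ using fun j => hG.enorm_iteratedDeriv_zero_le_geomSum hp j
  set P : ℝ≥0 := 2 * C₁ * (1 + C₂) with hP
  set R : ℝ≥0 := (C₄ + ∑ j ∈ Finset.range k, C₅ j) * C₃ with hR
  refine ⟨1 + P + R, by positivity, fun f hf => ?_⟩
  rw [hω.bergmanNormPow_eq hf hp, hω.derivativeNormPow_eq hf hp]
  set S := ∑ j ∈ Finset.range k, ‖iteratedDeriv j f 0‖ₑ ^ p with hS
  set I := ∫⁻ r, 2 * ENNReal.ofReal r * (derivMean p f k r * ENNReal.ofReal ((1 - r) ^ (k * p)))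
    ∂radialMeasure ω
  set J := ∫⁻ r, 2 * ENNReal.ofReal r * derivMean p f 0 r ∂radialMeasure ω with hJ
  constructor
  · calc J ≤ 2 * geomSum (radialMeasure ω) κ p f 0 := hG.lintegral_le_geomSum hp hf
      _ ≤ 2 * (C₁ * (S + C₂ * I)) := by
          gcongr
          refine (h₁ f hf).trans ?_
          gcongr
          exact h₂ f hf
      _ ≤ 2 * (C₁ * ((1 + C₂) * S + (1 + C₂) * I)) := by
          gcongr
          · exact le_mul_of_one_le_left' le_self_add
          · exact le_add_self
      _ = P * (I + S) := by rw [hP]; push_cast; ring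
      _ ≤ _ := by
          gcongr
          exact le_add_right le_add_self
  · have h0 : geomSum (radialMeasure ω) κ p f 0 ≤ C₃ * J := by
      have := h₃ f hf
      simpa [hJ] using this
    calc I + S ≤ C₄ * (C₃ * J) + ∑ j ∈ Finset.range k, C₅ j * (C₃ * J) := by
          refine add_le_add ((h₄ f hf).trans ?_) (Finset.sum_le_sum fun j _ => (h₅ j f hf).trans ?_)
          all_goals gcongr
      _ = R * J := by
          rw [hR, ← Finset.sum_mul]; push_cast; ring
      _ ≤ _ := by
          gcongr
          exact le_add_self

/-! ### Moments of the weight and the norms of monomials. -/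

theorem exp_neg_two_mul_le_one_sub {y : ℝ} (h0 : 0 ≤ y) (h1 : y ≤ 1 / 2) :
    Real.exp (-(2 * y)) ≤ 1 - y := by
  rw [Real.exp_neg, inv_le_iff_one_le_mul₀ (Real.exp_pos _)]
  have := Real.add_one_le_exp (2 * y)
  nlinarith

/-- With `x = n (1 - r)`, combine `x ^ k / k! ≤ e ^ x` and `r ^ n ≤ e ^ (-x)`. -/
theorem mul_one_sub_pow_mul_pow_le_factorial (n k : ℕ) {r : ℝ} (h0 : 0 ≤ r) (h1 : r ≤ 1) :
    (n * (1 - r)) ^ k * r ^ n ≤ k.factorial := by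
  have hx : 0 ≤ n * (1 - r) := mul_nonneg n.cast_nonneg (by linarith)
  have e1 := Real.pow_div_factorial_le_exp _ hx k
  rw [div_le_iff₀ (by positivity)] at e1
  have e2 : r ^ n ≤ Real.exp (-(n * (1 - r))) := by
    rw [show -(n * (1 - r)) = n * (r - 1) by ring, Real.exp_nat_mul]
    have := Real.add_one_le_exp (r - 1)
    exact pow_le_pow_left₀ h0 (by linarith) n
  calc (n * (1 - r)) ^ k * r ^ n
      ≤ (Real.exp (n * (1 - r)) * k.factorial) * Real.exp (-(n * (1 - r))) := by gcongr
    _ = k.factorial := by rw [Real.exp_neg]; field_simp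

/-- The moment of `ω` corresponding to the Bergman norm of `z ^ n`. -/
noncomputable def powMoment (ω : ℝ → ℝ) (p : ℝ) (n : ℕ) : ℝ :=
  ∫ r, r * (r ^ n) ^ p ∂radialMeasure ω

/-- The moment of `ω` corresponding to the norm of the `k`-th derivative of `z ^ n`. -/
noncomputable def derivMoment (ω : ℝ → ℝ) (p : ℝ) (k n : ℕ) : ℝ :=
  ∫ r, r * ((n * (1 - r)) ^ k * r ^ (n - k)) ^ p ∂radialMeasure ω

theorem derivMean_pow {p : ℝ} (hp : 0 < p) (n k : ℕ) {r : ℝ} (hr : 0 ≤ r) :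
    derivMean p (fun z => z ^ n) k r =
      ENNReal.ofReal (((n.descFactorial k : ℝ) * r ^ (n - k)) ^ p) := by
  have h : ∀ z : ℂ, ‖z‖ = ‖(r : ℂ)‖ → ‖iteratedDeriv k (fun z : ℂ => z ^ n) z‖ₑ ^ p =
      ENNReal.ofReal (((n.descFactorial k : ℝ) * r ^ (n - k)) ^ p) := by
    intro z hz
    rw [Complex.norm_real, Real.norm_of_nonneg hr] at hz
    rw [iteratedDeriv_pow, ← ofReal_norm,
      ENNReal.ofReal_rpow_of_nonneg (norm_nonneg _) hp.le]
    simp [hz]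
  exact le_antisymm (circleMean_le_of_forall_le fun w hw => (h w hw).le)
    ((circleMean_const _ _).symm.le.trans (circleMean_mono fun w hw => (h w hw).ge))

namespace IsRadialWeight

variable {ω : ℝ → ℝ} {p : ℝ}

theorem ae_mem_Ioo (ω : ℝ → ℝ) : ∀ᵐ r ∂radialMeasure ω, r ∈ Ioo (0 : ℝ) 1 :=
  radialMeasure_compl_Ioo ω

theorem integrable_of_bound (hω : IsRadialWeight ω) {φ : ℝ → ℝ} (hφ : Measurable φ) {B : ℝ}
    (hB : ∀ r ∈ Ioo (0 : ℝ) 1, |φ r| ≤ B) : Integrable φ (radialMeasure ω) := by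
  have := hω.isFiniteMeasure
  refine Integrable.of_bound hφ.aestronglyMeasurable B ?_
  filter_upwards [ae_mem_Ioo ω] with r hr using hB r hr

theorem integrable_mul_rpow_const (hω : IsRadialWeight ω) (hp : 0 < p) {b : ℝ} (hb : 0 ≤ b)
    (k m : ℕ) : Integrable (fun r : ℝ => r * (b * (1 - r) ^ k * r ^ m) ^ p) (radialMeasure ω) := by
  refine hω.integrable_of_bound (B := b ^ p) (by fun_prop) fun r hr => ?_
  have h1 : 0 ≤ 1 - r := by linarith [hr.2]
  have h0 := hr.1.le
  rw [abs_of_nonneg (by positivity)]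
  have : b * (1 - r) ^ k * r ^ m ≤ b := by
    calc b * (1 - r) ^ k * r ^ m ≤ b * 1 * 1 := by
          gcongr
          · exact pow_le_one₀ h1 (by linarith)
          · exact pow_le_one₀ h0 hr.2.le
      _ = b := by simp
  calc r * (b * (1 - r) ^ k * r ^ m) ^ p ≤ 1 * b ^ p := by
        gcongr
        exact hr.2.le
    _ = _ := one_mul _

theorem integrable_mul_rpow (hω : IsRadialWeight ω) (hp : 0 < p) {a : ℝ} (ha : 0 ≤ a) (k m : ℕ) :
    Integrable (fun r : ℝ => r * ((a * (1 - r)) ^ k * r ^ m) ^ p) (radialMeasure ω) := by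
  simpa only [mul_pow] using hω.integrable_mul_rpow_const hp (pow_nonneg ha k) k m

theorem integrable_powMoment (hω : IsRadialWeight ω) (hp : 0 < p) (n : ℕ) :
    Integrable (fun r => r * (r ^ n) ^ p) (radialMeasure ω) := by
  simpa using hω.integrable_mul_rpow hp zero_le_one 0 n

theorem integrable_indicator (hω : IsRadialWeight ω) {s : Set ℝ} (hs : MeasurableSet s) :
    Integrable (s.indicator (1 : ℝ → ℝ)) (radialMeasure ω) := by
  have := hω.isFiniteMeasure
  exact (integrable_const (1 : ℝ)).indicator hs

theorem integral_indicator_Ici (hω : IsRadialWeight ω) {s : ℝ} (h0 : 0 ≤ s) (h1 : s < 1) :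
    ∫ r, (Ici s).indicator 1 r ∂radialMeasure ω = tailIntegral ω s := by
  rw [integral_indicator_one measurableSet_Ici, measureReal_def, hω.radialMeasure_Ici h0 h1.le,
    ENNReal.toReal_ofReal (hω.tail_pos s ⟨h0, h1⟩).le]

theorem bergmanNormPow_pow (hω : IsRadialWeight ω) (hp : 0 < p) (n : ℕ) :
    bergmanNormPow ω p (fun z => z ^ n) = ENNReal.ofReal (2 * powMoment ω p n) := by
  rw [hω.bergmanNormPow_eq (f := fun z => z ^ n) (analyticOnNhd_id.pow n) hp, powMoment, ← integral_const_mul,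
    ofReal_integral_eq_lintegral_ofReal ((hω.integrable_powMoment hp n).const_mul 2)]
  · refine lintegral_congr_ae ?_
    filter_upwards [ae_mem_Ioo ω] with r hr
    rw [derivMean_pow hp n 0 hr.1.le, ENNReal.ofReal_mul (by norm_num : (0 : ℝ) ≤ 2),
      ENNReal.ofReal_mul hr.1.le]
    simp [mul_assoc]
  · filter_upwards [ae_mem_Ioo ω] with r hr
    have := hr.1
    simp only [Pi.zero_apply]
    positivity

theorem derivativeNormPow_pow (hω : IsRadialWeight ω) (hp : 0 < p) {n k : ℕ} (hkn : k ≤ n) :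
    derivativeNormPow ω p k (fun z => z ^ n) = ENNReal.ofReal
      (2 * ∫ r, r * (n.descFactorial k * (1 - r) ^ k * r ^ (n - k)) ^ p ∂radialMeasure ω) := by
  have hint := hω.integrable_mul_rpow_const hp (n.descFactorial k).cast_nonneg k (n - k)
  have hsum : ∑ j ∈ Finset.range k, ‖iteratedDeriv j (fun z : ℂ => z ^ n) 0‖ₑ ^ p = 0 := by
    refine Finset.sum_eq_zero fun j hj => ?_
    have hjn : n - j ≠ 0 := by have := Finset.mem_range.1 hj; omega
    rw [iteratedDeriv_pow]
    simp [hjn, hp]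
  rw [hω.derivativeNormPow_eq (f := fun z => z ^ n) (analyticOnNhd_id.pow n) hp, hsum, add_zero, ← integral_const_mul,
    ofReal_integral_eq_lintegral_ofReal (hint.const_mul 2)]
  · refine lintegral_congr_ae ?_
    filter_upwards [ae_mem_Ioo ω] with r hr
    have h1 : 0 ≤ 1 - r := by linarith [hr.2]
    have h0 := hr.1.le
    rw [derivMean_pow hp n k hr.1.le, ENNReal.ofReal_mul (by norm_num : (0 : ℝ) ≤ 2),
      ENNReal.ofReal_mul hr.1.le, ← ENNReal.ofReal_mul (by positivity), Real.rpow_mul h1,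
      Real.rpow_natCast, ← Real.mul_rpow (by positivity) (by positivity), mul_right_comm]
    simp only [mul_assoc, ENNReal.ofReal_ofNat]
    rw [mul_comm (ENNReal.ofReal r), mul_comm (r ^ (n - k))]
  · filter_upwards [ae_mem_Ioo ω] with r hr
    have h1 : 0 ≤ 1 - r := by linarith [hr.2]
    have h0 := hr.1
    simp only [Pi.zero_apply]
    positivity

theorem powMoment_nonneg (p : ℝ) (n : ℕ) : 0 ≤ powMoment ω p n := by
  refine integral_nonneg_of_ae ?_
  filter_upwards [ae_mem_Ioo ω] with r hr
  have := hr.1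
  simp only [Pi.zero_apply]
  positivity

theorem derivMoment_nonneg (p : ℝ) (k n : ℕ) : 0 ≤ derivMoment ω p k n := by
  refine integral_nonneg_of_ae ?_
  filter_upwards [ae_mem_Ioo ω] with r hr
  have h1 : 0 ≤ 1 - r := by linarith [hr.2]
  have h0 := hr.1
  simp only [Pi.zero_apply]
  positivity

/-- Testing the norm equivalence on monomials. -/
theorem exists_moment_bounds (hω : IsRadialWeight ω) (hp : 0 < p) (k : ℕ)
    (h : ∃ C : ℝ≥0, 0 < C ∧ ∀ f : ℂ → ℂ, AnalyticOnNhd ℂ f unitDisc →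
      bergmanNormPow ω p f ≤ C * derivativeNormPow ω p k f ∧
      derivativeNormPow ω p k f ≤ C * bergmanNormPow ω p f) :
    ∃ C : ℝ, 0 < C ∧ ∀ n : ℕ, 2 * k ≤ n →
      derivMoment ω p k n ≤ C * powMoment ω p n ∧ powMoment ω p n ≤ C * derivMoment ω p k n := by
  obtain ⟨C, hC, h⟩ := h
  have hC' : (0 : ℝ) < C := hC
  have hB1 : 1 ≤ ((2 : ℝ) ^ k) ^ p := Real.one_le_rpow (one_le_pow₀ (by norm_num)) hp.le
  refine ⟨((2 : ℝ) ^ k) ^ p * C, by positivity, fun n hn => ?_⟩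
  obtain ⟨hu, hl⟩ := h (fun z => z ^ n) (analyticOnNhd_id.pow n)
  rw [hω.bergmanNormPow_pow hp, hω.derivativeNormPow_pow hp (by omega)] at hu hl
  set I := ∫ r, r * (n.descFactorial k * (1 - r) ^ k * r ^ (n - k)) ^ p ∂radialMeasure ω with hI
  have hCe : (C : ℝ≥0∞) = ENNReal.ofReal C := (ENNReal.ofReal_coe_nnreal).symm
  have hA := powMoment_nonneg (ω := ω) p n
  have hdk : ((n.descFactorial k : ℕ) : ℝ) ≤ (n : ℝ) ^ k := by
    exact_mod_cast Nat.descFactorial_le_pow n k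
  -- For `n ≥ 2k` every factor of the descending factorial is at least `n / 2`.
  have hkd : (n : ℝ) ^ k ≤ 2 ^ k * (n.descFactorial k : ℕ) := by
    have h1 := Nat.pow_sub_le_descFactorial n k
    have h2 : n ≤ 2 * (n + 1 - k) := by omega
    have h3 : n ^ k ≤ 2 ^ k * n.descFactorial k :=
      (Nat.pow_le_pow_left h2 k).trans (by rw [mul_pow]; exact Nat.mul_le_mul_left _ h1)
    exact_mod_cast h3
  have hint := hω.integrable_mul_rpow_const hp (n.descFactorial k).cast_nonneg k (n - k)
  have hI0 : 0 ≤ I := by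
    refine integral_nonneg_of_ae ?_
    filter_upwards [ae_mem_Ioo ω] with r hr
    have h1 : 0 ≤ 1 - r := by linarith [hr.2]
    have h0 := hr.1
    simp only [Pi.zero_apply]
    positivity
  have hdI : derivMoment ω p k n ≤ (2 ^ k) ^ p * I := by
    rw [derivMoment, hI, ← integral_const_mul]
    refine integral_mono_ae (hω.integrable_mul_rpow hp n.cast_nonneg k _) (hint.const_mul _) ?_
    filter_upwards [ae_mem_Ioo ω] with r hr
    have h1 : 0 ≤ 1 - r := by linarith [hr.2]
    have h0 := hr.1.le
    have : (n * (1 - r)) ^ k * r ^ (n - k) ≤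
        2 ^ k * (n.descFactorial k * (1 - r) ^ k * r ^ (n - k)) := by
      rw [mul_pow]
      calc (n : ℝ) ^ k * (1 - r) ^ k * r ^ (n - k)
          ≤ (2 ^ k * (n.descFactorial k : ℕ)) * (1 - r) ^ k * r ^ (n - k) := by gcongr
        _ = _ := by ring
    calc _ ≤ r * (2 ^ k * (n.descFactorial k * (1 - r) ^ k * r ^ (n - k))) ^ p := by gcongr
      _ = _ := by rw [Real.mul_rpow (by positivity) (by positivity)]; ring
  have hId : I ≤ derivMoment ω p k n := by
    refine integral_mono_ae hint (hω.integrable_mul_rpow hp n.cast_nonneg k _) ?_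
    filter_upwards [ae_mem_Ioo ω] with r hr
    have h1 : 0 ≤ 1 - r := by linarith [hr.2]
    have h0 := hr.1.le
    rw [mul_pow (n : ℝ)]
    gcongr
  rw [hCe, ← ENNReal.ofReal_mul hC'.le, ENNReal.ofReal_le_ofReal_iff (by positivity)] at hu hl
  have hD := derivMoment_nonneg (ω := ω) p k n
  constructor
  · calc _ ≤ (2 ^ k) ^ p * I := hdI
      _ ≤ (2 ^ k) ^ p * (C * powMoment ω p n) := by gcongr; linarith
      _ = _ := by ring
  · calc powMoment ω p n ≤ 1 * (C * derivMoment ω p k n) := by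
          nlinarith [mul_le_mul_of_nonneg_left hId hC'.le]
      _ ≤ (2 ^ k) ^ p * (C * derivMoment ω p k n) := by gcongr
      _ = _ := by ring

/-! ### From moment bounds to doubling of the tails. -/

/-- Where `1 - r ≥ M / n`, the derivative integrand exceeds that of `z ^ n` by at least `M ^ (k p)`.
With `M ^ (k p) ≥ 2 C` this region contributes at most half of the moment and is absorbed. -/
theorem powMoment_le_tailIntegral (hω : IsRadialWeight ω) (hp : 0 < p) {k : ℕ} (hk : 1 ≤ k) {C : ℝ}
    (hC : 0 < C) (h : ∀ n : ℕ, 2 * k ≤ n → derivMoment ω p k n ≤ C * powMoment ω p n) :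
    ∃ M : ℝ, 1 ≤ M ∧ ∀ n : ℕ, 2 * k ≤ n → M ≤ n →
      powMoment ω p n ≤ 2 * tailIntegral ω (1 - M / n) := by
  set M := max 1 ((2 * C) ^ p⁻¹) with hM
  have hM1 : 1 ≤ M := le_max_left _ _
  have hMC : 2 * C ≤ (M ^ k) ^ p := by
    calc 2 * C = ((2 * C) ^ p⁻¹) ^ p := by
          rw [← Real.rpow_mul (by positivity), inv_mul_cancel₀ hp.ne', Real.rpow_one]
      _ ≤ (M ^ k) ^ p := by
          gcongr
          exact (le_max_right _ _).trans (le_self_pow₀ hM1 (by omega))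
  refine ⟨M, hM1, fun n hkn hMn => ?_⟩
  have hn0 : (0 : ℝ) < n := by linarith
  have hs0 : 0 ≤ 1 - M / n := sub_nonneg.2 ((div_le_one hn0).2 hMn)
  have hs1 : 1 - M / n < 1 := by have : 0 < M / n := by positivity
                                 linarith
  have hMk : 0 < (M ^ k) ^ p := by positivity
  have hle : powMoment ω p n ≤ ((M ^ k) ^ p)⁻¹ * derivMoment ω p k n + tailIntegral ω (1 - M / n) := by
    rw [← hω.integral_indicator_Ici hs0 hs1, derivMoment, ← integral_const_mul,
      ← integral_add ((hω.integrable_mul_rpow hp n.cast_nonneg k _).const_mul _)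
        (hω.integrable_indicator measurableSet_Ici)]
    refine integral_mono_ae (hω.integrable_powMoment hp n)
      (((hω.integrable_mul_rpow hp n.cast_nonneg k _).const_mul _).add
        (hω.integrable_indicator measurableSet_Ici)) ?_
    filter_upwards [ae_mem_Ioo ω] with r hr
    have h1 : 0 ≤ 1 - r := by linarith [hr.2]
    have h0 := hr.1.le
    by_cases hr' : 1 - M / n ≤ r
    · rw [indicator_of_mem (show r ∈ Ici (1 - M / n) from hr'), Pi.one_apply]
      have : (r ^ n) ^ p ≤ 1 := Real.rpow_le_one (by positivity) (pow_le_one₀ h0 hr.2.le) hp.le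
      have h2 : r * (r ^ n) ^ p ≤ 1 * 1 := mul_le_mul hr.2.le this (by positivity) zero_le_one
      have h3 : 0 ≤ ((M ^ k) ^ p)⁻¹ * (r * ((n * (1 - r)) ^ k * r ^ (n - k)) ^ p) := by positivity
      linarith
    · rw [indicator_of_notMem (show r ∉ Ici (1 - M / n) from hr'), add_zero, le_inv_mul_iff₀ hMk]
      have hMr : M ≤ n * (1 - r) := by
        have h2 : M / n ≤ 1 - r := by linarith
        rwa [div_le_iff₀' hn0] at h2
      calc (M ^ k) ^ p * (r * (r ^ n) ^ p) = r * (M ^ k * r ^ n) ^ p := by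
            rw [Real.mul_rpow (by positivity) (by positivity)]; ring
        _ ≤ r * ((n * (1 - r)) ^ k * r ^ (n - k)) ^ p := by
            gcongr r * ((?_) ^ _ * ?_) ^ _
            exact pow_le_pow_of_le_one h0 hr.2.le (by omega)
  have hA := powMoment_nonneg (ω := ω) p n
  have h2 : ((M ^ k) ^ p)⁻¹ * derivMoment ω p k n ≤ powMoment ω p n / 2 := by
    rw [inv_mul_le_iff₀ hMk]
    nlinarith [h n hkn, mul_le_mul_of_nonneg_right hMC hA]
  linarith

theorem exp_mul_tailIntegral_le_powMoment (hω : IsRadialWeight ω) (hp : 0 < p) {N : ℝ} (hN : 0 ≤ N)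
    {n : ℕ} (hn1 : 1 ≤ n) (hn : 2 * N ≤ n) :
    Real.exp (-(2 * N * p)) / 2 * tailIntegral ω (1 - N / n) ≤ powMoment ω p n := by
  have hn0 : (0 : ℝ) < n := by exact_mod_cast hn1
  have hhalf : N / n ≤ 1 / 2 := by rw [div_le_iff₀ hn0]; linarith
  have hNn : 0 ≤ N / n := by positivity
  -- For `N = 0` the tail starts at `1` and vanishes; `integral_indicator_Ici` needs a radius below
  -- `1`.
  rcases hN.eq_or_lt with rfl | hNpos
  · rw [zero_div, sub_zero, tailIntegral, intervalIntegral.integral_same, mul_zero]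
    exact powMoment_nonneg p n
  have hNn' : 0 < N / n := by positivity
  rw [← hω.integral_indicator_Ici (by linarith) (by linarith), ← integral_const_mul]
  refine integral_mono_ae ((hω.integrable_indicator measurableSet_Ici).const_mul _)
    (hω.integrable_powMoment hp n) ?_
  filter_upwards [ae_mem_Ioo ω] with r hr
  have h0 := hr.1.le
  by_cases hr' : 1 - N / n ≤ r
  · rw [indicator_of_mem (show r ∈ Ici (1 - N / n) from hr'), Pi.one_apply, mul_one]
    have e1 : Real.exp (-(2 * N * p)) ≤ (r ^ n) ^ p := by
      have e2 : Real.exp (-(2 * N * p)) = (Real.exp (-(2 * (N / n))) ^ n) ^ p := by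
        rw [← Real.exp_nat_mul, ← Real.exp_mul]
        congr 1
        field_simp
      rw [e2]
      have := exp_neg_two_mul_le_one_sub hNn hhalf
      gcongr
      linarith
    have : 1 / 2 ≤ r := by linarith
    nlinarith [Real.exp_pos (-(2 * N * p))]
  · rw [indicator_of_notMem (show r ∉ Ici (1 - N / n) from hr'), mul_zero]
    positivity

theorem isUpperDoubling_of_le (hω : IsRadialWeight ω) {M D : ℝ} {n₀ : ℕ} (hM : 1 ≤ M)
    (hn₀ : 4 * M ≤ n₀)
    (h : ∀ n : ℕ, n₀ ≤ n → tailIntegral ω (1 - 4 * M / n) ≤ D * tailIntegral ω (1 - M / n)) :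
    IsUpperDoubling ω := by
  have hn₀' : (0 : ℝ) < n₀ := by linarith
  have hMn : 0 < M / n₀ := by positivity
  have hMn' : M / n₀ ≤ 1 / 4 := by rw [div_le_iff₀ hn₀']; linarith
  have hT0 := hω.tail_pos (1 - M / n₀) ⟨by linarith, by linarith⟩
  set D' := tailIntegral ω 0 / tailIntegral ω (1 - M / n₀) with hD'
  refine ⟨max 1 (max D D'), le_max_left _ _, fun r hr => ?_⟩
  have h1r : 0 < 1 - r := by linarith [hr.2]
  have hpos := hω.tail_pos ((1 + r) / 2) ⟨by linarith [hr.1], by linarith [hr.2]⟩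
  by_cases hcase : n₀ ≤ 2 * M / (1 - r)
  -- This places `r` beyond `1 - 4M / n` and `(1 + r) / 2` before `1 - M / n`.
  · set n := ⌈2 * M / (1 - r)⌉₊ with hn
    have hn1 : 2 * M / (1 - r) ≤ n := Nat.le_ceil _
    have hn2 : (n : ℝ) < 2 * M / (1 - r) + 1 := Nat.ceil_lt_add_one (by positivity)
    have hnn₀ : n₀ ≤ n := by exact_mod_cast hcase.trans hn1
    have hnpos : (0 : ℝ) < n := by linarith
    have hn3 : (n : ℝ) ≤ 4 * M / (1 - r) := by
      have : 1 ≤ 2 * M / (1 - r) := by rw [le_div_iff₀ h1r]; linarith [hr.1]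
      have e : 4 * M / (1 - r) = 2 * M / (1 - r) + 2 * M / (1 - r) := by ring
      linarith
    have e1 : 1 - r ≤ 4 * M / n := by
      rw [le_div_iff₀ hnpos]; rw [le_div_iff₀ h1r] at hn3; linarith
    have e2 : M / n ≤ (1 - r) / 2 := by
      rw [div_le_iff₀ hnpos]; rw [div_le_iff₀ h1r] at hn1; linarith
    have e3 : 4 * M / n ≤ 1 := by
      rw [div_le_one hnpos]; exact hn₀.trans (by exact_mod_cast hnn₀)
    have e4 : 0 < M / n := by positivity
    have hTn := hω.tail_pos (1 - M / n) ⟨by linarith, by linarith⟩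
    calc tailIntegral ω r ≤ tailIntegral ω (1 - 4 * M / n) :=
          hω.tailIntegral_anti (by linarith) (by linarith) hr.2.le
      _ ≤ D * tailIntegral ω (1 - M / n) := h n hnn₀
      _ ≤ max 1 (max D D') * tailIntegral ω (1 - M / n) := by
          gcongr
          exact (le_max_left _ _).trans (le_max_right _ _)
      _ ≤ max 1 (max D D') * tailIntegral ω ((1 + r) / 2) := by
          refine mul_le_mul_of_nonneg_left ?_ (by positivity)
          exact hω.tailIntegral_anti (by linarith [hr.1]) (by linarith) (by linarith)
  -- Here `r` stays away from `1`, and the finite ratio `D'` suffices.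
  · have e1 : M / n₀ ≤ (1 - r) / 2 := by
      rw [not_le, div_lt_iff₀ h1r] at hcase
      rw [div_le_iff₀ hn₀']; linarith
    calc tailIntegral ω r ≤ tailIntegral ω 0 := hω.tailIntegral_anti le_rfl hr.1 hr.2.le
      _ = D' * tailIntegral ω (1 - M / n₀) := by rw [hD', div_mul_cancel₀ _ hT0.ne']
      _ ≤ max 1 (max D D') * tailIntegral ω (1 - M / n₀) := by
          gcongr
          exact (le_max_right _ _).trans (le_max_right _ _)
      _ ≤ max 1 (max D D') * tailIntegral ω ((1 + r) / 2) := by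
          refine mul_le_mul_of_nonneg_left ?_ (by positivity)
          exact hω.tailIntegral_anti (by linarith [hr.1]) (by linarith) (by linarith)

theorem isLowerDoubling_of_le (hω : IsRadialWeight ω) {L ε γ : ℝ} {n₀ : ℕ} (hL : 1 ≤ L)
    (hε : 0 < ε) (hε1 : ε ≤ 1) (hγ : 0 < γ) (hn₀ : L ≤ n₀)
    (h : ∀ n : ℕ, n₀ ≤ n → (1 + γ) * tailIntegral ω (1 - ε / n) ≤ tailIntegral ω (1 - L / n)) :
    IsLowerDoubling ω := by
  have hn₀' : (0 : ℝ) < n₀ := by linarith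
  -- `2L / ε` serves radii for which `n = ⌈L / (1 - r)⌉` is at least `n₀`, and `n₀ / ε` the
  -- remaining ones, for which `n = n₀`.
  set K := max 2 (max (2 * L / ε) (n₀ / ε)) with hK
  have hK2 : 2 ≤ K := le_max_left _ _
  have hKL : 2 * L / ε ≤ K := (le_max_left _ _).trans (le_max_right _ _)
  have hKn : n₀ / ε ≤ K := (le_max_right _ _).trans (le_max_right _ _)
  have hKpos : 0 < K := by linarith
  refine ⟨K, 1 + γ, by linarith, by linarith, fun r hr => ?_⟩
  have h1r : 0 < 1 - r := by linarith [hr.2]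
  have hrK : 0 < (1 - r) / K := by positivity
  obtain ⟨n, hn, hn1, hn2⟩ : ∃ n : ℕ, n₀ ≤ n ∧ 1 - L / n ≥ r ∧ (1 - r) / K ≤ ε / n := by
    by_cases hcase : n₀ ≤ L / (1 - r)
    · have hn1 : L / (1 - r) ≤ ⌈L / (1 - r)⌉₊ := Nat.le_ceil _
      have hn2 : (⌈L / (1 - r)⌉₊ : ℝ) < L / (1 - r) + 1 := Nat.ceil_lt_add_one (by positivity)
      refine ⟨⌈L / (1 - r)⌉₊, by exact_mod_cast hcase.trans hn1, ?_⟩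
      set n := ⌈L / (1 - r)⌉₊
      have hnpos : (0 : ℝ) < n := by linarith
      constructor
      · have : L / n ≤ 1 - r := by
          rw [div_le_iff₀ hnpos]; rw [div_le_iff₀ h1r] at hn1; linarith
        linarith
      · have : 1 ≤ L / (1 - r) := by rw [le_div_iff₀ h1r]; linarith [hr.1]
        have hn3 : (n : ℝ) * (1 - r) ≤ 2 * L := by
          have : (n : ℝ) ≤ 2 * L / (1 - r) := by
            have e : 2 * L / (1 - r) = L / (1 - r) + L / (1 - r) := by ring
            linarith
          rwa [le_div_iff₀ h1r] at this
        rw [div_le_div_iff₀ hKpos hnpos]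
        rw [div_le_iff₀ hε] at hKL
        linarith
    · rw [not_le, div_lt_iff₀ h1r] at hcase
      refine ⟨n₀, le_rfl, ?_, ?_⟩
      · have : L / n₀ ≤ 1 - r := by rw [div_le_iff₀ hn₀']; linarith
        linarith
      · rw [div_le_div_iff₀ hKpos hn₀']
        rw [div_le_iff₀ hε] at hKn
        nlinarith [hr.1]
  have hnL : L ≤ n := hn₀.trans (by exact_mod_cast hn)
  have hnpos : (0 : ℝ) < n := by linarith
  have hεn : ε / n ≤ 1 := by rw [div_le_one hnpos]; linarith
  calc (1 + γ) * tailIntegral ω (1 - (1 - r) / K)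
      ≤ (1 + γ) * tailIntegral ω (1 - ε / n) := by
        refine mul_le_mul_of_nonneg_left ?_ (by linarith)
        exact hω.tailIntegral_anti (by linarith) (by linarith) (by linarith)
    _ ≤ tailIntegral ω (1 - L / n) := h n hn
    _ ≤ tailIntegral ω r := by
        refine hω.tailIntegral_anti hr.1 hn1 ?_
        have : 0 < L / n := by positivity
        linarith

/-- Splitting the derivative moment of order `2n` at the radii `1 - L / n` and `1 - ε / n`. -/
theorem derivMoment_two_mul_le (hω : IsRadialWeight ω) (hp : 0 < p) {k n : ℕ} (hk : 1 ≤ k)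
    (hkn : 2 * k ≤ n) {L ε : ℝ} (hL : 1 ≤ L) (hLn : L ≤ n) (hε : 0 < ε) (hε1 : ε ≤ 1 / 2) :
    derivMoment ω p k (2 * n) ≤ (2 ^ k * k.factorial / L) ^ p * derivMoment ω p k n +
      (2 * ε) ^ p * tailIntegral ω (1 - ε / n) +
      ((2 * L) ^ k) ^ p * (tailIntegral ω (1 - L / n) - tailIntegral ω (1 - ε / n)) := by
  have hn0 : (0 : ℝ) < n := by linarith
  have hL1 : L / n ≤ 1 := (div_le_one hn0).2 hLn
  have hεn0 : 0 < ε / n := by positivity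
  have hεL : ε / n ≤ L / n := by gcongr; linarith
  rw [← hω.integral_indicator_Ici (s := 1 - L / n) (by linarith) (by linarith),
    ← hω.integral_indicator_Ici (s := 1 - ε / n) (by linarith) (by linarith),
    ← integral_sub (hω.integrable_indicator measurableSet_Ici)
      (hω.integrable_indicator measurableSet_Ici), derivMoment, derivMoment,
    ← integral_const_mul, ← integral_const_mul, ← integral_const_mul]
  have i1 := (hω.integrable_mul_rpow hp (n.cast_nonneg (α := ℝ)) k (n - k)).const_mul
    ((2 ^ k * k.factorial / L) ^ p)
  have i2 := (hω.integrable_indicator (measurableSet_Ici (a := 1 - ε / n))).const_mul ((2 * ε) ^ p)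
  have i3 := ((hω.integrable_indicator (measurableSet_Ici (a := 1 - L / n))).sub
    (hω.integrable_indicator (measurableSet_Ici (a := 1 - ε / n)))).const_mul (((2 * L) ^ k) ^ p)
  have i12 := i1.add i2
  simp only [Pi.sub_apply] at i3
  simp only [Pi.add_def] at i12
  rw [← integral_add i1 i2, ← integral_add i12 i3]
  refine integral_mono_ae (hω.integrable_mul_rpow hp (Nat.cast_nonneg _) k _) (i12.add i3) ?_
  filter_upwards [ae_mem_Ioo ω] with r hr
  have h1 : 0 ≤ 1 - r := by linarith [hr.2]
  have h0 := hr.1.le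
  have htriv : ∀ y : ℝ, 2 * n * (1 - r) ≤ y →
      r * (((2 * n : ℕ) * (1 - r)) ^ k * r ^ (2 * n - k)) ^ p ≤ (y ^ k) ^ p := by
    intro y hy
    have hy0 : 0 ≤ y := le_trans (by positivity) hy
    push_cast
    calc r * ((2 * n * (1 - r)) ^ k * r ^ (2 * n - k)) ^ p ≤ 1 * (y ^ k * 1) ^ p := by
          gcongr
          · exact hr.2.le
          · exact pow_le_one₀ h0 hr.2.le
      _ = _ := by simp
  by_cases hc1 : 1 - L / n ≤ r
  · rw [indicator_of_mem (show r ∈ Ici (1 - L / n) from hc1), Pi.one_apply]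
    have hpos : 0 ≤ (2 ^ k * k.factorial / L) ^ p *
        (r * ((n * (1 - r)) ^ k * r ^ (n - k)) ^ p) := by positivity
    by_cases hc2 : 1 - ε / n ≤ r
    · rw [indicator_of_mem (show r ∈ Ici (1 - ε / n) from hc2), Pi.one_apply]
      have h2 : n * (1 - r) ≤ ε := by
        have : 1 - r ≤ ε / n := by linarith
        rwa [le_div_iff₀' hn0] at this
      have h3 := htriv (2 * ε) (by linarith)
      have h4 : ((2 * ε) ^ k) ^ p ≤ (2 * ε) ^ p := by
        gcongr
        exact pow_le_of_le_one (by positivity) (by linarith) (by omega)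
      linarith
    · rw [indicator_of_notMem (show r ∉ Ici (1 - ε / n) from hc2)]
      have h2 : n * (1 - r) ≤ L := by
        have : 1 - r ≤ L / n := by linarith
        rwa [le_div_iff₀' hn0] at this
      have h3 := htriv (2 * L) (by linarith)
      linarith
  · rw [indicator_of_notMem (show r ∉ Ici (1 - L / n) from hc1),
      indicator_of_notMem (show r ∉ Ici (1 - ε / n) from fun h => hc1 (by
        have h' : 1 - ε / n ≤ r := h
        linarith))]
    have h2 : L ≤ n * (1 - r) := by
      have : L / n ≤ 1 - r := by linarith
      rwa [div_le_iff₀' hn0] at this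
    have h3 := mul_one_sub_pow_mul_pow_le_factorial n k h0 hr.2.le
    -- Doubling the exponent leaves a spare factor `r ^ n`, which is small far from the boundary.
    have h4 : r ^ n ≤ k.factorial / L := by
      rw [le_div_iff₀ (by linarith)]
      have h5 : L ≤ (n * (1 - r)) ^ k :=
        h2.trans (le_self_pow₀ (hL.trans h2) (by omega))
      calc r ^ n * L ≤ r ^ n * (n * (1 - r)) ^ k := by gcongr
        _ ≤ _ := by linarith
    have h6 : ((2 * n : ℕ) * (1 - r)) ^ k * r ^ (2 * n - k) ≤
        (2 ^ k * k.factorial / L) * ((n * (1 - r)) ^ k * r ^ (n - k)) := by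
      have e : 2 * n - k = n + (n - k) := by omega
      rw [e, pow_add]
      push_cast
      calc (2 * n * (1 - r)) ^ k * (r ^ n * r ^ (n - k))
          = 2 ^ k * r ^ n * ((n * (1 - r)) ^ k * r ^ (n - k)) := by
            rw [mul_assoc 2, mul_pow]; ring
        _ ≤ 2 ^ k * (k.factorial / L) * ((n * (1 - r)) ^ k * r ^ (n - k)) := by gcongr
        _ = _ := by ring
    calc _ ≤ r * ((2 ^ k * k.factorial / L) * ((n * (1 - r)) ^ k * r ^ (n - k))) ^ p := by
          gcongr
      _ = _ := by rw [Real.mul_rpow (by positivity) (by positivity)]; ring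

/-- For lower doubling, the outer two pieces of `derivMoment` at `2n` are made at most `A / (4C)`
each, with `A` the moment of order `2n`. As `A ≤ C * derivMoment`, the middle annulus must account
for `A / 2`, while `A` dominates the tail from `1 - L / n`. -/
theorem isTwoSidedDoubling_of_moment_bounds (hω : IsRadialWeight ω) (hp : 0 < p) {k : ℕ}
    (hk : 1 ≤ k) {C : ℝ} (hC : 0 < C)
    (h : ∀ n : ℕ, 2 * k ≤ n →
      derivMoment ω p k n ≤ C * powMoment ω p n ∧ powMoment ω p n ≤ C * derivMoment ω p k n) :
    IsTwoSidedDoubling ω := by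
  obtain ⟨M, hM1, hM⟩ := hω.powMoment_le_tailIntegral hp hk hC fun n hn => (h n hn).1
  set c : ℝ → ℝ := fun N => Real.exp (-(2 * N * p)) / 2 with hc
  have hcpos : ∀ N, 0 < c N := fun N => by positivity
  have hlow : ∀ (N : ℝ) (n : ℕ), 0 ≤ N → 1 ≤ n → 2 * N ≤ n →
      c N * tailIntegral ω (1 - N / n) ≤ powMoment ω p n :=
    fun N n hN hn1 hn => hω.exp_mul_tailIntegral_le_powMoment hp hN hn1 hn
  constructor
  -- The lower moment bound with `N = 4M` requires `2 N = 8M ≤ n`.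
  · set n₀ := max (2 * k) ⌈8 * M⌉₊ with hn₀
    have hn₀M : 8 * M ≤ n₀ := (Nat.le_ceil _).trans (by exact_mod_cast le_max_right _ _)
    refine hω.isUpperDoubling_of_le (M := M) (D := 2 / c (4 * M)) (n₀ := n₀) hM1 (by linarith)
      fun n hn => ?_
    have hnM : 8 * M ≤ n := hn₀M.trans (by exact_mod_cast hn)
    have hkn : 2 * k ≤ n := (le_max_left _ _).trans hn
    have h1 := hM n hkn (by linarith)
    have h2 := hlow (4 * M) n (by linarith) (by omega) (by linarith)
    rw [div_mul_eq_mul_div, le_div_iff₀ (hcpos _)]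
    linarith
  -- `a` and `b` are the sizes that make the inner and the near-boundary piece at most `A / (4 *
  -- C)`; `L` and `ε` are then chosen to reach them.
  · set a := c (2 * M) / (8 * C ^ 2) with ha
    have hapos : 0 < a := div_pos (hcpos _) (by positivity)
    set b := c 1 / (4 * C) with hb
    have hbpos : 0 < b := div_pos (hcpos _) (by positivity)
    set L := max 1 (2 ^ k * k.factorial / a ^ p⁻¹) with hL
    have hL1 : 1 ≤ L := le_max_left _ _
    have hap : 0 < a ^ p⁻¹ := Real.rpow_pos_of_pos hapos _
    have hLa : (2 ^ k * k.factorial / L) ^ p ≤ a := by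
      calc (2 ^ k * k.factorial / L) ^ p ≤ (a ^ p⁻¹) ^ p := by
            gcongr
            rw [div_le_iff₀ (by linarith)]
            have := le_max_right 1 (2 ^ k * k.factorial / a ^ p⁻¹)
            rw [div_le_iff₀ hap] at this
            linarith
        _ = a := by rw [← Real.rpow_mul hapos.le, inv_mul_cancel₀ hp.ne', Real.rpow_one]
    set ε := min (1 / 2) (b ^ p⁻¹ / 2) with hε
    have hbp : 0 < b ^ p⁻¹ := Real.rpow_pos_of_pos hbpos _
    have hε0 : 0 < ε := lt_min (by norm_num) (by positivity)
    have hε2 : ε ≤ 1 / 2 := min_le_left _ _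
    have hεb : (2 * ε) ^ p ≤ b := by
      calc (2 * ε) ^ p ≤ (b ^ p⁻¹) ^ p := by
            gcongr
            linarith [min_le_right (1 / 2) (b ^ p⁻¹ / 2)]
        _ = b := by rw [← Real.rpow_mul hbpos.le, inv_mul_cancel₀ hp.ne', Real.rpow_one]
    set P := ((2 * L) ^ k) ^ p with hP
    have hPpos : 0 < P := by positivity
    set γ := c (2 * L) / (2 * C * P) with hγ
    have hγpos : 0 < γ := div_pos (hcpos _) (by positivity)
    set n₀ := max (2 * k) ⌈2 * M + 2 * L⌉₊ with hn₀
    have hn₀M : 2 * M + 2 * L ≤ n₀ := (Nat.le_ceil _).trans (by exact_mod_cast le_max_right _ _)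
    refine hω.isLowerDoubling_of_le hL1 hε0 (by linarith) hγpos (n₀ := n₀) (by linarith)
      fun n hn => ?_
    have hnM : 2 * M + 2 * L ≤ n := hn₀M.trans (by exact_mod_cast hn)
    have hkn : 2 * k ≤ n := (le_max_left _ _).trans hn
    have hn0 : (0 : ℝ) < n := by linarith
    have hsplit := hω.derivMoment_two_mul_le hp hk hkn hL1 (by linarith) hε0 hε2
    have hcast : ((2 * n : ℕ) : ℝ) = 2 * n := by push_cast; ring
    have e2 : ∀ N : ℝ, (2 * N) / ((2 * n : ℕ) : ℝ) = N / n := fun N => by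
      rw [hcast, mul_div_mul_left _ _ two_ne_zero]
    have hlow2 : ∀ N : ℝ, 0 ≤ N → 2 * N ≤ n →
        c (2 * N) * tailIntegral ω (1 - N / n) ≤ powMoment ω p (2 * n) := fun N hN hNn => by
      have := hlow (2 * N) (2 * n) (by linarith) (by omega) (by rw [hcast]; linarith)
      rwa [e2] at this
    have hA2 := (h (2 * n) (by omega)).2
    have hE := (h n hkn).1
    have hAn := hM n hkn (by linarith)
    have hM2 := hlow2 M (by linarith) (by linarith)
    have hL2 := hlow2 L (by linarith) (by linarith)
    have h12 := hlow2 (1 / 2) (by norm_num) (by linarith)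
    have hεn : ε / n ≤ (1 / 2) / n := by gcongr
    have hhalf : (1 / 2 : ℝ) / n ≤ 1 := by rw [div_le_one hn0]; linarith
    have hεL : ε / n ≤ L / n := by gcongr; linarith
    have hLn1 : L / n ≤ 1 := by rw [div_le_one hn0]; linarith
    have hεn0 : 0 < ε / n := by positivity
    have hTε : tailIntegral ω (1 - ε / n) ≤ tailIntegral ω (1 - (1 / 2) / n) :=
      hω.tailIntegral_anti (by linarith) (by linarith) (by linarith)
    have hTL : tailIntegral ω (1 - ε / n) ≤ tailIntegral ω (1 - L / n) :=
      hω.tailIntegral_anti (by linarith) (by linarith) (by linarith)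
    have hTε0 := hω.tail_pos (1 - ε / n) ⟨by linarith, by linarith⟩
    set A := powMoment ω p (2 * n) with hAdef
    set Tε := tailIntegral ω (1 - ε / n)
    set TL := tailIntegral ω (1 - L / n)
    set TM := tailIntegral ω (1 - M / n)
    have hEn := derivMoment_nonneg (ω := ω) p k n
    have hc21 : c (2 * (1 / 2)) = c 1 := by norm_num
    rw [hc21] at h12
    -- The moments of order `n` return to order `2n` through the tail from `1 - M / n`, which bounds
    -- the former above and the latter below.
    have t1 : (2 ^ k * k.factorial / L) ^ p * derivMoment ω p k n ≤ A / (4 * C) := by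
      calc _ ≤ a * (C * (2 * TM)) := by
            refine mul_le_mul hLa (hE.trans ?_) hEn hapos.le
            exact mul_le_mul_of_nonneg_left hAn hC.le
        _ = (c (2 * M) * TM) / (4 * C) := by rw [ha]; field_simp; ring
        _ ≤ A / (4 * C) := by gcongr
    have t2 : (2 * ε) ^ p * Tε ≤ A / (4 * C) := by
      calc _ ≤ b * Tε := by gcongr
        _ = (c 1 * Tε) / (4 * C) := by rw [hb]; ring
        _ ≤ A / (4 * C) := by
            gcongr
            exact (mul_le_mul_of_nonneg_left hTε (hcpos 1).le).trans h12
    have t3 : A ≤ A / 2 + C * (P * (TL - Tε)) := by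
      calc A ≤ C * derivMoment ω p k (2 * n) := hA2
        _ ≤ C * (A / (4 * C) + A / (4 * C) + P * (TL - Tε)) := by
            refine mul_le_mul_of_nonneg_left ?_ hC.le
            linarith
        _ = _ := by field_simp; ring
    have t4 : γ * TL ≤ TL - Tε := by
      rw [hγ, div_mul_eq_mul_div, div_le_iff₀ (by positivity)]
      linarith
    have t5 : γ * Tε ≤ γ * TL := by gcongr
    linarith

end IsRadialWeight

theorem theorem5 (ω : ℝ → ℝ) (hω : IsRadialWeight ω) (p : ℝ) (hp : 0 < p) (k : ℕ) (hk : 1 ≤ k) :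
    (∃ C : ℝ≥0, 0 < C ∧ ∀ f : ℂ → ℂ, AnalyticOnNhd ℂ f unitDisc →
      bergmanNormPow ω p f ≤ C * derivativeNormPow ω p k f ∧
      derivativeNormPow ω p k f ≤ C * bergmanNormPow ω p f) ↔
    IsTwoSidedDoubling ω := by
  refine ⟨fun h => ?_, exists_norm_equivalence hω hp k⟩
  obtain ⟨C, hC, hb⟩ := hω.exists_moment_bounds hp k h
  exact hω.isTwoSidedDoubling_of_moment_bounds hp hk hC hb
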